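/- Let $k$ be a field and $N\ge 2$ an integer. For a finite-dimensional $k$-vector space $V$ and a subspace $R\subseteq V^{\otimes N}$, the $N$-homogeneous algebra on $V$ with space of relations $R$ is $A=\mathrm{Tens}(V)/I(R)$, where $I(R)$ is the two-sided ideal generated by $R$; it is a connected graded algebra, generated by $V$ in degree $1$. The algebra $A$ is called distributive if for every $n\ge N$ the sublattice of the lattice of subspaces of $V^{\otimes n}$ generated by the subspaces $V^{\otimes i}\otimes R\otimes V^{\otimes j}$, $i+j+N=n$, is distributive. The algebra $A$ is called (generalized) Koszul if for every $i\ge 3$ the graded vector space $\mathrm{Tor}^A_i(k,k)$ is concentrated in degree $n(i)$, where $n(2q)=qN$ and $n(2q+1)=qN+1$ for all integers $q\ge 0$. **Proposition 2.8.** Let $A$ and $A'$ be $N$-homogeneous algebras on finite-dimensional $k$-vector spaces $V$ and $V'$, with spaces of relations $R$ and $R'$, respectively. Let $A\bullet A'$ be their Manin product, i.e. the $N$-homogeneous algebra on $V\otimes V'$ whose space of relations is $R\otimes R'$, viewed in $(V\otimes V')^{\otimes N}$ through the canonical isomorphism $V^{\otimes N}\otimes V'^{\otimes N}\cong (V\otimes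 V')^{\otimes N}$. If $A$ and $A'$ are distributive and Koszul, then $A\bullet A'$ is Koszul. -/

import Mathlib

open scoped TensorProduct

noncomputable section

namespace HomogAlg

universe u v w

/-- The degree `n` part `V^{⊗ n}` of the tensor algebra of `V`, as a subspace of `Tens(V)`. -/
def tensorDeg (k : Type u) (V : Type v) [Field k] [AddCommGroup V] [Module k V] (n : ℕ) :
    Submodule k (TensorAlgebra k V) :=
  LinearMap.range (TensorAlgebra.ι k (M := V)) ^ n

section Basic

variable {k : Type u} {V : Type v} [Field k] [AddCommGroup V] [Module k V] {N : ℕ}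

/-- The space of relations `R ⊆ V^{⊗ N}`, seen in the tensor algebra. -/
def relSpace (R : Submodule k (⨂[k]^N V)) : Submodule k (TensorAlgebra k V) :=
  R.map TensorPower.toTensorAlgebra

/-- The subspace `V^{⊗ i} ⊗ R ⊗ V^{⊗ j}` of `V^{⊗ (i + N + j)} ⊆ Tens(V)`. -/
def relAt (R : Submodule k (⨂[k]^N V)) (i j : ℕ) : Submodule k (TensorAlgebra k V) :=
  tensorDeg k V i * relSpace R * tensorDeg k V j

/-- The `N`-homogeneous algebra with space of relations `R` is distributive: for every `n ≥ N`, the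
sublattice generated by the subspaces `V^{⊗ i} ⊗ R ⊗ V^{⊗ j}` with `i + j + N = n` is distributive.
All these subspaces lie in the degree `n` part of `Tens(V)`; sums and intersections are the same
whether they are formed in `V^{⊗ n}` or in `Tens(V)`. -/
def IsDistributive (R : Submodule k (⨂[k]^N V)) : Prop :=
  ∀ n : ℕ, N ≤ n →
    ∀ X ∈ latticeClosure {Y | ∃ i j : ℕ, i + j + N = n ∧ Y = relAt R i j},
    ∀ Y ∈ latticeClosure {Y | ∃ i j : ℕ, i + j + N = n ∧ Y = relAt R i j},
    ∀ Z ∈ latticeClosure {Y | ∃ i j : ℕ, i + j + N = n ∧ Y = relAt R i j},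
      X ⊓ (Y ⊔ Z) = (X ⊓ Y) ⊔ (X ⊓ Z)

/-- The two-sided ideal `I(R)` of `Tens(V)` generated by `R`. -/
def relIdeal (R : Submodule k (⨂[k]^N V)) : Ideal (TensorAlgebra k V) :=
  (TwoSidedIdeal.span (relSpace R : Set (TensorAlgebra k V))).asIdeal

instance (R : Submodule k (⨂[k]^N V)) : (relIdeal R).IsTwoSided :=
  inferInstanceAs (TwoSidedIdeal.asIdeal _).IsTwoSided

/-- The `N`-homogeneous algebra `A = Tens(V) / I(R)`. -/
abbrev Alg (R : Submodule k (⨂[k]^N V)) : Type (max u v) :=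
  TensorAlgebra k V ⧸ relIdeal R

/-- The degree `n` part `A_n` of `A`, the image of `V^{⊗ n}`. -/
def algDeg (R : Submodule k (⨂[k]^N V)) (n : ℕ) : Submodule k (Alg R) :=
  (tensorDeg k V n).map (Ideal.Quotient.mkₐ k (relIdeal R)).toLinearMap

/-- The augmentation ideal `A_+` of `A`, generated by (in fact equal to the sum of) the `A_n` with
`n ≥ 1`. -/
def augIdeal (R : Submodule k (⨂[k]^N V)) : Ideal (Alg R) :=
  Ideal.span {a | ∃ n : ℕ, 1 ≤ n ∧ a ∈ algDeg R n}

/-- The trivial graded left `A`-module `k = A / A_+`, concentrated in degree `0`. -/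
abbrev TrivialModule (R : Submodule k (⨂[k]^N V)) : Type (max u v) :=
  Alg R ⧸ augIdeal R

/-- The vector space `k ⊗_A M = M / A_+ M`, for a left `A`-module `M` (here `k` is the trivial right
`A`-module). -/
abbrev Coinv (R : Submodule k (⨂[k]^N V)) (M : Type (max u v)) [AddCommGroup M]
    [Module (Alg R) M] : Type (max u v) :=
  M ⧸ (augIdeal R • (⊤ : Submodule (Alg R) M))

/-- The map `k ⊗_A f : k ⊗_A M → k ⊗_A M'` induced by an `A`-linear map `f : M → M'`. -/
def coinvMap (R : Submodule k (⨂[k]^N V)) {M M' : Type (max u v)} [AddCommGroup M] [AddCommGroup M']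
    [Module (Alg R) M] [Module (Alg R) M'] (f : M →ₗ[Alg R] M') : Coinv R M →ₗ[Alg R] Coinv R M' :=
  Submodule.mapQ _ _ f <| by
    rw [← Submodule.map_le_iff_le_comap, Submodule.map_smul'']
    exact smul_mono_right _ le_top

/-- A resolution of the trivial module `k` by graded free left `A`-modules, with homogeneous maps of
degree `0`. -/
structure GradedFreeResolution (R : Submodule k (⨂[k]^N V)) where
  /-- The modules of the resolution. -/
  P : ℕ → Type (max u v)
  [addCommGroup : ∀ i, AddCommGroup (P i)]
  [moduleBase : ∀ i, Module k (P i)]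
  [module : ∀ i, Module (Alg R) (P i)]
  [isScalarTower : ∀ i, IsScalarTower k (Alg R) (P i)]
  /-- The degree `n` part of `P i`. -/
  deg : ∀ i, ℕ → Submodule k (P i)
  isInternal : ∀ i, DirectSum.IsInternal (deg i)
  smul_mem : ∀ i m n (a : Alg R) (x : P i), a ∈ algDeg R m → x ∈ deg i n → a • x ∈ deg i (m + n)
  /-- The index set of a basis of `P i`. -/
  ι : ℕ → Type (max u v)
  /-- A basis of `P i` over `A`, which consists of homogeneous elements. -/
  basis : ∀ i, Module.Basis (ι i) (Alg R) (P i)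
  basis_mem : ∀ i (b : ι i), ∃ n, basis i b ∈ deg i n
  /-- The differential. -/
  d : ∀ i, P (i + 1) →ₗ[Alg R] P i
  d_mem : ∀ i n x, x ∈ deg (i + 1) n → d i x ∈ deg i n
  /-- The augmentation. -/
  aug : P 0 →ₗ[Alg R] TrivialModule R
  aug_eq_zero : ∀ n x, 1 ≤ n → x ∈ deg 0 n → aug x = 0
  aug_surjective : Function.Surjective aug
  exact_zero : Function.Exact (d 0) aug
  exact_succ : ∀ i, Function.Exact (d (i + 1)) (d i)

attribute [instance] GradedFreeResolution.addCommGroup GradedFreeResolution.moduleBase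
  GradedFreeResolution.module GradedFreeResolution.isScalarTower

namespace GradedFreeResolution

variable {R : Submodule k (⨂[k]^N V)} (F : GradedFreeResolution R)

/-- The degree `n` part of the graded vector space `k ⊗_A P_i`. -/
def coinvDeg (i n : ℕ) : Submodule k (Coinv R (F.P i)) :=
  (F.deg i n).map
    ((Submodule.mkQ (augIdeal R • (⊤ : Submodule (Alg R) (F.P i)))).restrictScalars k)

/-- The `i`-cycles of degree `n` of the complex `k ⊗_A P`. -/
def cycles : ∀ i : ℕ, ℕ → Submodule k (Coinv R (F.P i))
  | 0, n => F.coinvDeg 0 n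
  | i + 1, n => F.coinvDeg (i + 1) n ⊓ LinearMap.ker ((coinvMap R (F.d i)).restrictScalars k)

/-- The `i`-boundaries of degree `n` of the complex `k ⊗_A P`. -/
def boundaries (i n : ℕ) : Submodule k (Coinv R (F.P i)) :=
  (F.coinvDeg (i + 1) n).map ((coinvMap R (F.d i)).restrictScalars k)

/-- The degree `n` part of the graded vector space `Tor_i^A(k, k) = H_i(k ⊗_A P)`, computed from the
resolution `P`. -/
abbrev Tor (i n : ℕ) : Type (max u v) :=
  F.cycles i n ⧸ (F.boundaries i n).submoduleOf (F.cycles i n)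

end GradedFreeResolution

/-- The jump map `n(2q) = q N`, `n(2q + 1) = q N + 1`. -/
def jump (N i : ℕ) : ℕ := i / 2 * N + i % 2

/-- The `N`-homogeneous algebra `A` with space of relations `R` is (generalized) Koszul: for every
`i ≥ 3`, the graded vector space `Tor_i^A(k, k)` is concentrated in degree `n(i)`. The graded vector
space `Tor_i^A(k, k)` does not depend, up to isomorphism, on the resolution which computes it. -/
def IsKoszul (R : Submodule k (⨂[k]^N V)) : Prop :=
  ∃ F : GradedFreeResolution R, ∀ i n : ℕ, 3 ≤ i → n ≠ jump N i → Subsingleton (F.Tor i n)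

/-- The space of relations `R ⊗ R' ⊆ V^{⊗ N} ⊗ V'^{⊗ N} ≅ (V ⊗ V')^{⊗ N}` of the Manin product
`A • A'`: it is spanned by the images of the `r ⊗ r'` under the canonical isomorphism, which sends
`(v_1 ⊗ ⋯ ⊗ v_N) ⊗ (v'_1 ⊗ ⋯ ⊗ v'_N)` to `(v_1 ⊗ v'_1) ⊗ ⋯ ⊗ (v_N ⊗ v'_N)`. -/
def maninRel {V' : Type w} [AddCommGroup V'] [Module k V'] (R : Submodule k (⨂[k]^N V))
    (R' : Submodule k (⨂[k]^N V')) : Submodule k (⨂[k]^N (V ⊗[k] V')) :=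
  Submodule.map₂ (PiTensorProduct.map₂ fun _ => TensorProduct.mk k V V') R R'

end Basic

end HomogAlg

end

/-! Write `T` for the tensor algebra, `I` for the ideal of relations and `W_n ⊆ V^{⊗ n}` for the
intersection of all `V^{⊗ i} ⊗ R ⊗ V^{⊗ j}`. The proof rests on Berger's extra condition
(`ExtraCondition`): `V^{⊗ (m+1)} ⊗ R` and `R ⊗ V^{⊗ (m+1)}` meet inside `V^{⊗ m} ⊗ R ⊗ V` for `1 ≤ m
< N - 1`.

Koszulness forces the extra condition (`IsKoszul.extraCondition`): as `Tor_3` lives in degree `N +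
1`, new syzygies of `A ⊗ R → A ⊗ V` appear only in that degree, where they lie in `R ⊗ V`. Hence
those of degree `N + m + 1 < 2N` lie in `V^{⊗ m} ⊗ R ⊗ V`.

Conversely, distributivity and the extra condition give Koszulness (`isKoszul_of_infDistrib`): they
make the Koszul complex with terms `A ⊗ W_{n(i)}` exact. Since `A ⊗ W = TW / IW` for `W` in a single
degree, exactness is an inclusion between subspaces of `T`, checked degree by degree
(`koszul_exact`).

Both properties pass to the Manin product, whose relation subspaces are the tensor products of those
of `A` and `A'`. A distributive family has an adapted basis (`exists_adapted_basis`), and the tensor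
product of two adapted bases is adapted to the product family (`infDistrib_maninRel`). The extra
condition passes because intersections commute with tensor products of subspaces (`tens_inf_tens`).
-/

open scoped TensorProduct

noncomputable section

namespace HomogAlg

universe u v w

/-! ### Tensor products of subspaces. -/

section LinearAlgebra

variable {k : Type*} [Field k] {M N : Type*} [AddCommGroup M] [Module k M] [AddCommGroup N]
  [Module k N]

/-- The subspace `P ⊗ Q` of `M ⊗ N`. -/
abbrev tens (P : Submodule k M) (Q : Submodule k N) : Submodule k (M ⊗[k] N) :=
  Submodule.map₂ (TensorProduct.mk k M N) P Q

lemma mem_tens_top_iff {κ : Type*} [DecidableEq κ] (c : Module.Basis κ k N) (P : Submodule k M) (x : M ⊗[k] N) :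
    x ∈ tens P ⊤ ↔ ∀ j, TensorProduct.equivFinsuppOfBasisRight c x j ∈ P := by
  refine ⟨fun hx j => ?_, fun h => ?_⟩
  · have : tens P ⊤ ≤ P.comap
        (Finsupp.lapply j ∘ₗ (TensorProduct.equivFinsuppOfBasisRight (M := M) c).toLinearMap) := by
      refine Submodule.map₂_le.2 fun m hm n _ => ?_
      simpa using P.smul_mem _ hm
    exact this hx
  · obtain ⟨y, rfl⟩ := (TensorProduct.equivFinsuppOfBasisRight (M := M) c).symm.surjective x
    simp only [LinearEquiv.apply_symm_apply] at h
    rw [TensorProduct.equivFinsuppOfBasisRight_symm_apply]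
    refine Submodule.sum_mem _ fun j _ => Submodule.apply_mem_map₂ _ ?_ trivial
    exact h j

lemma mem_top_tens_iff {κ : Type*} [DecidableEq κ] (c : Module.Basis κ k M) (Q : Submodule k N) (x : M ⊗[k] N) :
    x ∈ tens ⊤ Q ↔ ∀ j, TensorProduct.equivFinsuppOfBasisLeft c x j ∈ Q := by
  refine ⟨fun hx j => ?_, fun h => ?_⟩
  · have : tens ⊤ Q ≤ Q.comap
        (Finsupp.lapply j ∘ₗ (TensorProduct.equivFinsuppOfBasisLeft (N := N) c).toLinearMap) := by
      refine Submodule.map₂_le.2 fun m _ n hn => ?_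
      simpa using Q.smul_mem _ hn
    exact this hx
  · obtain ⟨y, rfl⟩ := (TensorProduct.equivFinsuppOfBasisLeft (N := N) c).symm.surjective x
    simp only [LinearEquiv.apply_symm_apply] at h
    rw [TensorProduct.equivFinsuppOfBasisLeft_symm_apply]
    refine Submodule.sum_mem _ fun j _ => Submodule.apply_mem_map₂ _ trivial ?_
    exact h j

/-- If `f` is a linear projection onto `P`, then `f ⊗ id` fixes `P ⊗ N` and maps `M ⊗ Q` into `P ⊗
Q`. -/
lemma tens_top_inf_top_tens (P : Submodule k M) (Q : Submodule k N) :
    tens P ⊤ ⊓ tens ⊤ Q ≤ tens P Q := by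
  obtain ⟨f, hf⟩ := LinearMap.exists_leftInverse_of_injective P.subtype P.ker_subtype
  have h1 : tens P ⊤ ≤ LinearMap.eqLocus (LinearMap.rTensor N (P.subtype ∘ₗ f)) LinearMap.id := by
    refine Submodule.map₂_le.2 fun m hm n _ => ?_
    have : f m = ⟨m, hm⟩ := LinearMap.congr_fun hf ⟨m, hm⟩
    simp [this]
  have h2 : tens ⊤ Q ≤ (tens P Q).comap (LinearMap.rTensor N (P.subtype ∘ₗ f)) := by
    refine Submodule.map₂_le.2 fun m _ n hn => ?_
    exact Submodule.apply_mem_map₂ _ (f m).2 hn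
  rintro x ⟨hx, hx'⟩
  have := h2 hx'
  rwa [Submodule.mem_comap, LinearMap.mem_eqLocus.1 (h1 hx)] at this

-- When one factor is the whole space, membership is tested on coordinates along a basis of that
-- factor, so intersections are immediate; the general case reduces to `tens_top_inf_top_tens`.
open Classical in
lemma tens_inf_tens (P P' : Submodule k M) (Q Q' : Submodule k N) :
    tens P Q ⊓ tens P' Q' = tens (P ⊓ P') (Q ⊓ Q') := by
  apply le_antisymm
  · refine le_trans (le_inf ?_ ?_) (tens_top_inf_top_tens _ _)
    · intro x hx
      rw [mem_tens_top_iff (Module.Basis.ofVectorSpace k N)]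
      have h1 := (mem_tens_top_iff (Module.Basis.ofVectorSpace k N) P x).1
        (Submodule.map₂_le_map₂_right le_top hx.1)
      have h2 := (mem_tens_top_iff (Module.Basis.ofVectorSpace k N) P' x).1
        (Submodule.map₂_le_map₂_right le_top hx.2)
      exact fun j => ⟨h1 j, h2 j⟩
    · intro x hx
      rw [mem_top_tens_iff (Module.Basis.ofVectorSpace k M)]
      have h1 := (mem_top_tens_iff (Module.Basis.ofVectorSpace k M) Q x).1
        (Submodule.map₂_le_map₂_left le_top hx.1)
      have h2 := (mem_top_tens_iff (Module.Basis.ofVectorSpace k M) Q' x).1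
        (Submodule.map₂_le_map₂_left le_top hx.2)
      exact fun j => ⟨h1 j, h2 j⟩
  · exact le_inf (Submodule.map₂_le_map₂ inf_le_left inf_le_left)
      (Submodule.map₂_le_map₂ inf_le_right inf_le_right)

lemma tens_span_basis {ι κ : Type*} (b : Module.Basis ι k M) (c : Module.Basis κ k N) (s : Set ι)
    (t : Set κ) : tens (Submodule.span k (b '' s)) (Submodule.span k (c '' t)) =
      Submodule.span k (b.tensorProduct c '' (s ×ˢ t)) := by
  rw [tens, Submodule.map₂_span_span]
  congr 1
  ext x
  simp only [Set.mem_image2, Set.mem_image, Set.mem_prod, Prod.exists]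
  constructor
  · rintro ⟨_, ⟨i, hi, rfl⟩, _, ⟨j, hj, rfl⟩, rfl⟩
    exact ⟨i, j, ⟨hi, hj⟩, by simp⟩
  · rintro ⟨i, j, ⟨hi, hj⟩, rfl⟩
    exact ⟨_, ⟨i, hi, rfl⟩, _, ⟨j, hj, rfl⟩, by simp⟩

/-- A linear map that sends basis vectors injectively to basis vectors is injective on their
span. -/
lemma injOn_span_basis {ι κ : Type*} (b : Module.Basis ι k M) (c : Module.Basis κ k N)
    (f : M →ₗ[k] N) (g : ι → κ) (hfg : ∀ i, f (b i) = c (g i)) {s : Set ι} (hg : s.InjOn g) :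
    Set.InjOn f (Submodule.span k (b '' s) : Set M) := by
  have key : ∀ x, c.repr (f x) = Finsupp.mapDomain g (b.repr x) := by
    intro x
    have : c.repr.toLinearMap ∘ₗ f = Finsupp.lmapDomain k k g ∘ₗ b.repr.toLinearMap := by
      refine b.ext fun i => ?_
      simp [hfg, Finsupp.mapDomain_single]
    exact LinearMap.congr_fun this x
  intro x hx y hy hxy
  apply b.repr.injective
  refine Finsupp.mapDomain_injOn s hg ?_ ?_ ?_
  · exact b.mem_span_image.1 hx
  · exact b.mem_span_image.1 hy
  · rw [← key, ← key, hxy]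

lemma span_basis_image_inf {ι : Type*} (b : Module.Basis ι k M) (s t : Set ι) :
    Submodule.span k (b '' s) ⊓ Submodule.span k (b '' t) = Submodule.span k (b '' (s ∩ t)) := by
  ext x
  simp only [Submodule.mem_inf, b.mem_span_image, Set.subset_inter_iff]

end LinearAlgebra

/-! ### Word bases of the tensor algebra and unique factorization. -/

section Words

variable {k : Type u} {V : Type v} [Field k] [AddCommGroup V] [Module k V]

lemma basis_tensorAlgebra_apply {κ : Type*} (b : Module.Basis κ k V) (w : FreeMonoid κ) :
    b.tensorAlgebra w = FreeMonoid.lift (fun i => TensorAlgebra.ι k (b i)) w := by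
  have : b.tensorAlgebra w = (TensorAlgebra.equivFreeAlgebra b).symm
      (FreeAlgebra.equivMonoidAlgebraFreeMonoid.symm (MonoidAlgebra.of k (FreeMonoid κ) w)) := rfl
  rw [this]
  have h2 : (MonoidHomClass.toMonoidHom (((TensorAlgebra.equivFreeAlgebra b).symm.toAlgHom).comp
      (FreeAlgebra.equivMonoidAlgebraFreeMonoid (R := k) (X := κ)).symm.toAlgHom)).comp
      (MonoidAlgebra.of k (FreeMonoid κ)) = FreeMonoid.lift (fun i => TensorAlgebra.ι k (b i)) := by
    ext i
    simp [FreeAlgebra.equivMonoidAlgebraFreeMonoid]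
  exact DFunLike.congr_fun h2 w

lemma basis_tensorAlgebra_mul {κ : Type*} (b : Module.Basis κ k V) (w w' : FreeMonoid κ) :
    b.tensorAlgebra (w * w') = b.tensorAlgebra w * b.tensorAlgebra w' := by
  simp [basis_tensorAlgebra_apply]

lemma tensorDeg_eq_span {κ : Type*} (b : Module.Basis κ k V) (n : ℕ) :
    tensorDeg k V n = Submodule.span k (b.tensorAlgebra '' {w | w.length = n}) := by
  have h1 : LinearMap.range (TensorAlgebra.ι k (M := V)) =
      Submodule.span k (b.tensorAlgebra '' {w | w.length = 1}) := by
    rw [LinearMap.range_eq_map, ← b.span_eq, Submodule.map_span]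
    congr 1
    ext x
    simp only [Set.mem_image, Set.mem_range, exists_exists_eq_and, Set.mem_ofPred_eq,
      FreeMonoid.length_eq_one]
    constructor
    · rintro ⟨i, rfl⟩
      exact ⟨_, ⟨i, rfl⟩, by simp [basis_tensorAlgebra_apply]⟩
    · rintro ⟨_, ⟨i, rfl⟩, rfl⟩
      exact ⟨i, by simp [basis_tensorAlgebra_apply]⟩
  induction n with
  | zero =>
    rw [tensorDeg, pow_zero, Submodule.one_eq_span]
    congr 1
    ext x
    simp [basis_tensorAlgebra_apply, FreeMonoid.length_eq_zero]
  | succ n ih =>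
    rw [tensorDeg] at ih ⊢
    rw [pow_succ, ih, h1, Submodule.span_mul_span]
    congr 1
    ext x
    simp only [Set.mem_mul, Set.mem_image, Set.mem_ofPred_eq, exists_exists_and_eq_and]
    constructor
    · rintro ⟨w, hw, w', hw', rfl⟩
      exact ⟨w * w', by simp [hw, hw'], basis_tensorAlgebra_mul b w w'⟩
    · rintro ⟨w, hw, rfl⟩
      refine ⟨FreeMonoid.ofList (w.toList.take n), ?_, FreeMonoid.ofList (w.toList.drop n), ?_, ?_⟩
      · have : w.toList.length = n + 1 := hw
        change (w.toList.take n).length = n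
        simp [this]
      · have : w.toList.length = n + 1 := hw
        change (w.toList.drop n).length = 1
        simp [this]
      · rw [← basis_tensorAlgebra_mul, ← FreeMonoid.ofList_append, List.take_append_drop]
        rfl

lemma mul_eq_map_tens (P Q : Submodule k (TensorAlgebra k V)) :
    P * Q = (tens P Q).map (LinearMap.mul' k (TensorAlgebra k V)) := by
  apply le_antisymm
  · exact Submodule.mul_le.2 fun p hp q hq => ⟨p ⊗ₜ q, Submodule.apply_mem_map₂ _ hp hq, by simp⟩
  · refine Submodule.map_le_iff_le_comap.2 (Submodule.map₂_le.2 fun p hp q hq => ?_)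
    exact Submodule.mul_mem_mul hp hq

/-- A word has at most one factorization whose right factor has length `n`, so multiplication is
injective on the corresponding basis vectors. -/
lemma injOn_mul' (n : ℕ) : Set.InjOn (LinearMap.mul' k (TensorAlgebra k V))
    (tens (M := TensorAlgebra k V) ⊤ (tensorDeg k V n) : Set (TensorAlgebra k V ⊗[k] TensorAlgebra k V)) := by
  let b := Module.Basis.ofVectorSpace k V
  have := injOn_span_basis (b.tensorAlgebra.tensorProduct b.tensorAlgebra) b.tensorAlgebra
    (LinearMap.mul' k (TensorAlgebra k V)) (fun p => p.1 * p.2)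
    (fun p => by
      rw [Module.Basis.tensorProduct_apply', LinearMap.mul'_apply, basis_tensorAlgebra_mul]) (s := Set.univ ×ˢ {w | w.length = n}) ?_
  · rw [← tens_span_basis, ← tensorDeg_eq_span] at this
    simpa [b.tensorAlgebra.span_eq] using this
  · rintro ⟨p, q⟩ ⟨-, hq⟩ ⟨p', q'⟩ ⟨-, hq'⟩ h
    simp only [Set.mem_ofPred_eq] at hq hq' h
    have := List.append_inj' (s₁ := p.toList) (t₁ := q.toList) (s₂ := p'.toList)
      (t₂ := q'.toList) h (hq.trans hq'.symm)
    exact Prod.ext this.1 this.2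

/-- Fixing the degree of the right factors turns products of subspaces into tensor products, where
`tens_inf_tens` applies. -/
lemma mul_inf_mul {n : ℕ} (P P' : Submodule k (TensorAlgebra k V))
    {S S' : Submodule k (TensorAlgebra k V)} (hS : S ≤ tensorDeg k V n)
    (hS' : S' ≤ tensorDeg k V n) : P * S ⊓ P' * S' = (P ⊓ P') * (S ⊓ S') := by
  simp only [mul_eq_map_tens, ← tens_inf_tens]
  apply le_antisymm
  · rintro _ ⟨⟨x, hx, rfl⟩, ⟨y, hy, hxy⟩⟩
    have := injOn_mul' n (Submodule.map₂_le_map₂ le_top hS' hy)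
      (Submodule.map₂_le_map₂ le_top hS hx) hxy
    subst this
    exact ⟨y, ⟨hx, hy⟩, rfl⟩
  · exact Submodule.map_inf_le _

end Words

/-! ### Homogeneous subspaces of the tensor algebra. -/

section Grading

variable {k : Type u} {V : Type v} [Field k] [AddCommGroup V] [Module k V]

instance : GradedAlgebra (tensorDeg k V) := TensorAlgebra.gradedAlgebra

lemma tensorDeg_mul (m n : ℕ) : tensorDeg k V m * tensorDeg k V n = tensorDeg k V (m + n) :=
  (pow_add _ m n).symm

lemma tensorDeg_zero : tensorDeg k V 0 = 1 := pow_zero _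

variable (k V) in
/-- The projection of `Tens(V)` onto its degree `n` part. -/
def proj (n : ℕ) : TensorAlgebra k V →ₗ[k] TensorAlgebra k V :=
  GradedAlgebra.proj (tensorDeg k V) n

lemma proj_mem (n : ℕ) (x : TensorAlgebra k V) : proj k V n x ∈ tensorDeg k V n :=
  SetLike.coe_mem (DirectSum.decompose (tensorDeg k V) x n)

lemma proj_of_mem {n : ℕ} {x : TensorAlgebra k V} (hx : x ∈ tensorDeg k V n) :
    proj k V n x = x :=
  DirectSum.decompose_of_mem_same (tensorDeg k V) hx

lemma proj_of_mem_ne {m n : ℕ} {x : TensorAlgebra k V} (hx : x ∈ tensorDeg k V m) (h : m ≠ n) :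
    proj k V n x = 0 :=
  DirectSum.decompose_of_mem_ne (tensorDeg k V) hx h

open Classical in
lemma exists_sum_proj (x : TensorAlgebra k V) : ∃ s : Finset ℕ, x = ∑ n ∈ s, proj k V n x :=
  ⟨_, (DirectSum.sum_support_decompose (tensorDeg k V) x).symm⟩

lemma mem_of_proj_mem {S : Submodule k (TensorAlgebra k V)} {x : TensorAlgebra k V}
    (h : ∀ n, proj k V n x ∈ S) : x ∈ S := by
  obtain ⟨s, hs⟩ := exists_sum_proj x
  rw [hs]
  exact S.sum_mem fun n _ => h n

lemma proj_mul_of_mem_right {l : ℕ} {w : TensorAlgebra k V} (hw : w ∈ tensorDeg k V l) (m : ℕ)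
    (x : TensorAlgebra k V) : proj k V (m + l) (x * w) = proj k V m x * w := by
  obtain ⟨s, hs⟩ := exists_sum_proj x
  have key : ∀ n, proj k V (m + l) (proj k V n x * w) = if n = m then proj k V m x * w else 0 := by
    intro n
    have h1 : proj k V n x * w ∈ tensorDeg k V (n + l) := by
      rw [← tensorDeg_mul]; exact Submodule.mul_mem_mul (proj_mem n x) hw
    split_ifs with h
    · subst h; exact proj_of_mem h1
    · exact proj_of_mem_ne h1 (by omega)
  have key' : ∀ n, proj k V m (proj k V n x) = if n = m then proj k V m x else 0 := by
    intro n
    split_ifs with h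
    · subst h; exact proj_of_mem (proj_mem _ _)
    · exact proj_of_mem_ne (proj_mem _ _) h
  have e1 : proj k V (m + l) (x * w) = if m ∈ s then proj k V m x * w else 0 := by
    conv_lhs => rw [hs, Finset.sum_mul, map_sum]
    simp [key]
  have e2 : proj k V m x = if m ∈ s then proj k V m x else 0 := by
    conv_lhs => rw [hs, map_sum]
    simp [key']
  rw [e1]
  split_ifs with h
  · rfl
  · rw [if_neg h] at e2
    rw [e2, zero_mul]

lemma proj_mul_of_mem_right_lt {l n : ℕ} {w : TensorAlgebra k V} (hw : w ∈ tensorDeg k V l)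
    (h : n < l) (x : TensorAlgebra k V) : proj k V n (x * w) = 0 := by
  obtain ⟨s, hs⟩ := exists_sum_proj x
  rw [hs, Finset.sum_mul, map_sum]
  refine Finset.sum_eq_zero fun i _ => ?_
  have h1 : proj k V i x * w ∈ tensorDeg k V (i + l) := by
    rw [← tensorDeg_mul]; exact Submodule.mul_mem_mul (proj_mem i x) hw
  exact proj_of_mem_ne h1 (by omega)

/-- A graded subspace of the tensor algebra. -/
def IsHomog (S : Submodule k (TensorAlgebra k V)) : Prop :=
  ∀ n, ∀ x ∈ S, proj k V n x ∈ S

lemma isHomog_top : IsHomog (⊤ : Submodule k (TensorAlgebra k V)) := fun _ _ _ => trivial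

lemma isHomog_of_le {l : ℕ} {S : Submodule k (TensorAlgebra k V)} (h : S ≤ tensorDeg k V l) :
    IsHomog S := by
  intro n x hx
  by_cases hn : l = n
  · subst hn; rwa [proj_of_mem (h hx)]
  · rw [proj_of_mem_ne (h hx) hn]; exact S.zero_mem

lemma IsHomog.inf {S S' : Submodule k (TensorAlgebra k V)} (h : IsHomog S) (h' : IsHomog S') :
    IsHomog (S ⊓ S') :=
  fun n x hx => ⟨h n x hx.1, h' n x hx.2⟩

lemma IsHomog.mul {S S' : Submodule k (TensorAlgebra k V)} (h : IsHomog S) (h' : IsHomog S') :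
    IsHomog (S * S') := by
  intro n x hx
  refine (Submodule.mul_le (P := (S * S').comap (proj k V n))).2 (fun s hs s' hs' => ?_) hx
  obtain ⟨t, ht⟩ := exists_sum_proj s'
  rw [Submodule.mem_comap, ht, Finset.mul_sum, map_sum]
  refine Submodule.sum_mem _ fun i _ => ?_
  rcases lt_or_ge n i with hi | hi
  · rw [proj_mul_of_mem_right_lt (proj_mem i s') hi]
    exact Submodule.zero_mem _
  · obtain ⟨m, rfl⟩ := Nat.exists_eq_add_of_le' hi
    rw [proj_mul_of_mem_right (proj_mem i s')]
    exact Submodule.mul_mem_mul (h _ _ hs) (h' _ _ hs')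

/-- Right multiplication by an element of degree `l` shifts the projections onto the graded parts by
`l`. -/
lemma IsHomog.mul_inf_tensorDeg_le {S W : Submodule k (TensorAlgebra k V)} (h : IsHomog S) {l : ℕ}
    (hW : W ≤ tensorDeg k V l) (m : ℕ) :
    S * W ⊓ tensorDeg k V (m + l) ≤ (S ⊓ tensorDeg k V m) * W := by
  rintro x ⟨hx, hx'⟩
  rw [← proj_of_mem hx']
  refine (Submodule.mul_le (P := ((S ⊓ tensorDeg k V m) * W).comap (proj k V (m + l)))).2
    (fun s hs w hw => ?_) hx
  rw [Submodule.mem_comap, proj_mul_of_mem_right (hW hw)]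
  exact Submodule.mul_mem_mul ⟨h _ _ hs, proj_mem _ _⟩ hw

lemma mul_inf_tensorDeg_eq_bot (S : Submodule k (TensorAlgebra k V))
    {W : Submodule k (TensorAlgebra k V)} {l n : ℕ} (hW : W ≤ tensorDeg k V l) (hn : n < l) :
    S * W ⊓ tensorDeg k V n = ⊥ := by
  rw [eq_bot_iff]
  rintro x ⟨hx, hx'⟩
  rw [← proj_of_mem hx']
  refine (Submodule.mul_le (P := (⊥ : Submodule k (TensorAlgebra k V)).comap (proj k V n))).2
    (fun s hs w hw => ?_) hx
  rw [Submodule.mem_comap, proj_mul_of_mem_right_lt (hW hw) hn]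
  exact Submodule.zero_mem _

lemma proj_mem_iSup {ι : Type*} {S : ι → Submodule k (TensorAlgebra k V)} {d : ι → ℕ}
    (hS : ∀ i, S i ≤ tensorDeg k V (d i)) {n : ℕ} {x : TensorAlgebra k V} (hx : x ∈ ⨆ i, S i) :
    proj k V n x ∈ ⨆ i, ⨆ (_ : d i = n), S i := by
  have : ⨆ i, S i ≤ (⨆ i, ⨆ (_ : d i = n), S i).comap (proj k V n) := by
    refine iSup_le fun i y hy => ?_
    by_cases hi : d i = n
    · rw [Submodule.mem_comap, proj_of_mem (hi ▸ hS i hy)]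
      exact le_iSup₂_of_le (f := fun i (_ : d i = n) => S i) i hi le_rfl hy
    · rw [Submodule.mem_comap, proj_of_mem_ne (hS i hy) hi]
      exact Submodule.zero_mem _
  exact this hx

lemma iSup_tensorDeg : ⨆ n, tensorDeg k V n = ⊤ :=
  top_le_iff.1 fun _ _ => mem_of_proj_mem fun n => Submodule.mem_iSup_of_mem n (proj_mem n _)

end Grading

/-! ### The ideal of relations and its graded parts. -/

section Relations

variable {k : Type u} {V : Type v} [Field k] [AddCommGroup V] [Module k V] {N : ℕ}

lemma range_toTensorAlgebra_le (n : ℕ) :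
    LinearMap.range (TensorPower.toTensorAlgebra (R := k) (M := V) (n := n)) ≤ tensorDeg k V n := by
  rw [LinearMap.range_eq_map, ← PiTensorProduct.span_tprod_eq_top, Submodule.map_span,
    Submodule.span_le]
  rintro _ ⟨_, ⟨x, rfl⟩, rfl⟩
  rw [TensorPower.toTensorAlgebra_tprod, TensorAlgebra.tprod_apply]
  have := SetLike.list_prod_ofFn_mem_graded (A := tensorDeg k V) (fun _ : Fin n => 1)
    (fun i => TensorAlgebra.ι k (x i)) (fun i => by rw [tensorDeg, pow_one]; exact ⟨_, rfl⟩)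
  simpa using this

lemma relSpace_le (R : Submodule k (⨂[k]^N V)) : relSpace R ≤ tensorDeg k V N :=
  LinearMap.map_le_range.trans (range_toTensorAlgebra_le N)

variable (R : Submodule k (⨂[k]^N V))

lemma relAt_le (i j : ℕ) : relAt R i j ≤ tensorDeg k V (i + N + j) := by
  rw [← tensorDeg_mul, ← tensorDeg_mul]
  exact mul_le_mul' (mul_le_mul' le_rfl (relSpace_le R)) le_rfl

lemma tensorDeg_mul_relAt (m i j : ℕ) : tensorDeg k V m * relAt R i j = relAt R (m + i) j := by
  rw [relAt, relAt, ← tensorDeg_mul, mul_assoc, mul_assoc, mul_assoc]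

lemma relAt_mul_tensorDeg (m i j : ℕ) : relAt R i j * tensorDeg k V m = relAt R i (j + m) := by
  simp only [relAt, ← tensorDeg_mul, mul_assoc]

/-- The ideal of relations, as a subspace of the tensor algebra. -/
def relSub : Submodule k (TensorAlgebra k V) := ⊤ * relSpace R * ⊤

lemma top_mul_top_tensorAlgebra :
    (⊤ : Submodule k (TensorAlgebra k V)) * (⊤ : Submodule k (TensorAlgebra k V)) = ⊤ :=
  top_le_iff.1 fun x _ => by
    simpa using Submodule.mul_mem_mul (M := ⊤) (N := ⊤) (Submodule.mem_top (R := k) (x := x))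
      (Submodule.mem_top (R := k) (x := (1 : TensorAlgebra k V)))

lemma le_top_mul (S : Submodule k (TensorAlgebra k V)) : S ≤ ⊤ * S := fun x hx => by
  simpa using Submodule.mul_mem_mul (M := ⊤) (Submodule.mem_top (x := (1 : TensorAlgebra k V))) hx

lemma top_mul_relSub : ⊤ * relSub R = relSub R := by
  rw [relSub, ← mul_assoc, ← mul_assoc, top_mul_top_tensorAlgebra]

lemma relSub_mul_top : relSub R * ⊤ = relSub R := by
  rw [relSub, mul_assoc, top_mul_top_tensorAlgebra]

lemma relSpace_le_relSub : relSpace R ≤ relSub R := fun x hx => by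
  have := Submodule.mul_mem_mul (le_top_mul _ hx)
    (Submodule.mem_top (R := k) (x := (1 : TensorAlgebra k V)))
  rwa [mul_one] at this

lemma mem_relIdeal {x : TensorAlgebra k V} : x ∈ relIdeal R ↔ x ∈ relSub R := by
  constructor
  · intro hx
    let J : TwoSidedIdeal (TensorAlgebra k V) := TwoSidedIdeal.mk' (relSub R)
      (Submodule.zero_mem _) (Submodule.add_mem _) (Submodule.neg_mem _)
      (fun {x y} hy => by
        rw [← top_mul_relSub]; exact Submodule.mul_mem_mul trivial hy)
      (fun {x y} hx => by
        rw [← relSub_mul_top]; exact Submodule.mul_mem_mul hx trivial)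
    have h1 : TwoSidedIdeal.span (relSpace R : Set (TensorAlgebra k V)) ≤ J := by
      rw [TwoSidedIdeal.span_le]
      intro y hy
      rw [SetLike.mem_coe, TwoSidedIdeal.mem_mk']
      exact relSpace_le_relSub R hy
    have := h1 (show x ∈ TwoSidedIdeal.span (relSpace R : Set (TensorAlgebra k V)) from hx)
    rwa [TwoSidedIdeal.mem_mk'] at this
  · have : relSub R ≤ (relIdeal R).restrictScalars k := by
      refine Submodule.mul_le.2 fun y hy t _ => ?_
      have h2 : ⊤ * relSpace R ≤ (relIdeal R).restrictScalars k := by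
        refine Submodule.mul_le.2 fun t _ r hr => ?_
        exact Ideal.mul_mem_left _ _ (TwoSidedIdeal.subset_span hr)
      exact Ideal.mul_mem_right _ _ (h2 hy)
    exact fun hx => this hx

lemma isHomog_relSub : IsHomog (relSub R) :=
  (isHomog_top.mul (isHomog_of_le (relSpace_le R))).mul isHomog_top

lemma relSub_eq_iSup : relSub R = ⨆ p : ℕ × ℕ, relAt R p.1 p.2 := by
  rw [relSub, ← iSup_tensorDeg, Submodule.iSup_mul, Submodule.iSup_mul, iSup_prod]
  simp_rw [Submodule.mul_iSup, relAt]

lemma relSub_inf_tensorDeg (m : ℕ) :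
    relSub R ⊓ tensorDeg k V m ≤ ⨆ p : ℕ × ℕ, ⨆ (_ : p.1 + N + p.2 = m), relAt R p.1 p.2 := by
  rintro x ⟨hx, hx'⟩
  rw [relSub_eq_iSup] at hx
  rw [← proj_of_mem hx']
  exact proj_mem_iSup (fun p : ℕ × ℕ => relAt_le R p.1 p.2) hx

lemma relAt_le_relSub (i j : ℕ) : relAt R i j ≤ relSub R :=
  mul_le_mul' (mul_le_mul' le_top le_rfl) le_top

end Relations

/-! ### Free modules `A ⊗ W` as quotients `TW / IW`, and resolutions built from them. -/

section FreeModules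

variable {k : Type u} {V : Type v} [Field k] [AddCommGroup V] [Module k V] {N : ℕ}
  (R : Submodule k (⨂[k]^N V)) {W W' : Submodule k (TensorAlgebra k V)} {l l' : ℕ}

/-- The `A`-linear extension `A ⊗ U → M` of a `k`-linear map `U → M`. -/
def freeLift {U M : Type*} [AddCommGroup U] [Module k U] [AddCommGroup M] [Module k M]
    [Module (Alg R) M] [IsScalarTower k (Alg R) M] (f : U →ₗ[k] M) :
    Alg R ⊗[k] U →ₗ[Alg R] M :=
  TensorProduct.AlgebraTensorModule.lift
    (LinearMap.toSpanSingleton (Alg R) (U →ₗ[k] M) f)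

@[simp] lemma freeLift_tmul {U M : Type*} [AddCommGroup U] [Module k U] [AddCommGroup M]
    [Module k M] [Module (Alg R) M] [IsScalarTower k (Alg R) M] (f : U →ₗ[k] M) (a : Alg R)
    (x : U) : freeLift R f (a ⊗ₜ x) = a • f x := rfl

variable (W) in
/-- The multiplication map `Tens(V) ⊗ W → Tens(V)`. -/
def mulInto : TensorAlgebra k V ⊗[k] W →ₗ[k] TensorAlgebra k V :=
  LinearMap.mul' k (TensorAlgebra k V) ∘ₗ LinearMap.lTensor _ W.subtype

@[simp] lemma mulInto_tmul (t : TensorAlgebra k V) (x : W) : mulInto W (t ⊗ₜ x) = t * x := rfl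

lemma ker_mulInto (hW : W ≤ tensorDeg k V l) : LinearMap.ker (mulInto W) = ⊥ := by
  rw [LinearMap.ker_eq_bot']
  intro x hx
  have h1 : ∀ y : TensorAlgebra k V ⊗[k] W, LinearMap.lTensor (TensorAlgebra k V) W.subtype y ∈
      (tens (M := TensorAlgebra k V) ⊤ (tensorDeg k V l)) := by
    intro y
    induction y using TensorProduct.induction_on with
    | zero => simp
    | tmul t x => exact Submodule.apply_mem_map₂ _ trivial (hW x.2)
    | add y z hy hz => rw [map_add]; exact Submodule.add_mem _ hy hz
  have h2 := injOn_mul' l (h1 x) (Submodule.zero_mem _) (by rw [map_zero]; exact hx)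
  have h3 : Function.Injective (LinearMap.lTensor (TensorAlgebra k V) W.subtype) :=
    Module.Flat.lTensor_preserves_injective_linearMap _ W.injective_subtype
  exact h3 (by rw [h2, map_zero])

/-- A linear map that is inverse to the multiplication map `Tens(V) ⊗ W → Tens(V)` on its image. -/
def mulIntoInv (hW : W ≤ tensorDeg k V l) : TensorAlgebra k V →ₗ[k] TensorAlgebra k V ⊗[k] W :=
  (LinearMap.exists_leftInverse_of_injective (mulInto W) (ker_mulInto hW)).choose

lemma mulIntoInv_mulInto (hW : W ≤ tensorDeg k V l) (x : TensorAlgebra k V ⊗[k] W) :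
    mulIntoInv hW (mulInto W x) = x :=
  LinearMap.congr_fun
    (LinearMap.exists_leftInverse_of_injective (mulInto W) (ker_mulInto hW)).choose_spec x

lemma range_mulInto (W : Submodule k (TensorAlgebra k V)) :
    LinearMap.range (mulInto W) = ⊤ * W := by
  apply le_antisymm
  · rintro _ ⟨x, rfl⟩
    induction x using TensorProduct.induction_on with
    | zero => simp
    | tmul t x => exact Submodule.mul_mem_mul trivial x.2
    | add x y hx hy => rw [map_add]; exact Submodule.add_mem _ hx hy
  · exact Submodule.mul_le.2 fun t _ w hw => ⟨t ⊗ₜ ⟨w, hw⟩, rfl⟩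

/-- The quotient map `Tens(V) → A`. -/
abbrev quot : TensorAlgebra k V →ₗ[k] Alg R := (Ideal.Quotient.mkₐ k (relIdeal R)).toLinearMap

/-- The map `Tens(V) W ≅ Tens(V) ⊗ W → A ⊗ W`, extended to the tensor algebra. -/
def toFree (hW : W ≤ tensorDeg k V l) : TensorAlgebra k V →ₗ[k] Alg R ⊗[k] W :=
  LinearMap.rTensor W (quot R) ∘ₗ mulIntoInv hW

lemma toFree_mul (hW : W ≤ tensorDeg k V l) (t : TensorAlgebra k V) (x : W) :
    toFree R hW (t * x) = quot R t ⊗ₜ x := by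
  have := mulIntoInv_mulInto hW (t ⊗ₜ x)
  rw [mulInto_tmul] at this
  rw [toFree, LinearMap.comp_apply, this]
  rfl

lemma toFree_mul_mem (hW : W ≤ tensorDeg k V l) {x : TensorAlgebra k V} (hx : x ∈ ⊤ * W)
    (t : TensorAlgebra k V) : toFree R hW (t * x) = quot R t • toFree R hW x := by
  induction hx using Submodule.mul_induction_on' with
  | mem_mul_mem s hs w hw =>
    rw [← mul_assoc, toFree_mul R hW (t * s) ⟨w, hw⟩, toFree_mul R hW s ⟨w, hw⟩,
      TensorProduct.smul_tmul']
    congr 1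
  | add x hx y hy h h' => rw [mul_add, map_add, map_add, h, h', smul_add]

lemma toFree_surj (hW : W ≤ tensorDeg k V l) (p : Alg R ⊗[k] W) :
    ∃ x ∈ ⊤ * W, toFree R hW x = p := by
  induction p using TensorProduct.induction_on with
  | zero => exact ⟨0, Submodule.zero_mem _, map_zero _⟩
  | tmul a x =>
    obtain ⟨t, rfl⟩ := Ideal.Quotient.mk_surjective a
    exact ⟨t * x, Submodule.mul_mem_mul trivial x.2, toFree_mul R hW t x⟩
  | add p q hp hq =>
    obtain ⟨x, hx, rfl⟩ := hp
    obtain ⟨y, hy, rfl⟩ := hq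
    exact ⟨x + y, Submodule.add_mem _ hx hy, map_add _ _ _⟩

/-- This is the dictionary between `A ⊗ W` and the tensor algebra: by right exactness the kernel of
`T ⊗ W → A ⊗ W` is the image of `I ⊗ W`. -/
lemma toFree_eq_zero_iff (hW : W ≤ tensorDeg k V l) {x : TensorAlgebra k V} (hx : x ∈ ⊤ * W) :
    toFree R hW x = 0 ↔ x ∈ relSub R * W := by
  constructor
  · intro h
    rw [← range_mulInto] at hx
    obtain ⟨y, rfl⟩ := hx
    rw [toFree, LinearMap.comp_apply, mulIntoInv_mulInto] at h
    have hex : Function.Exact (relSub R).subtype (quot R) := by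
      intro z
      have : quot R z = 0 ↔ z ∈ relIdeal R := Ideal.Quotient.eq_zero_iff_mem
      rw [this, mem_relIdeal]
      simp
    obtain ⟨z, rfl⟩ := (rTensor_exact W hex Ideal.Quotient.mk_surjective y).1 h
    clear h
    induction z using TensorProduct.induction_on with
    | zero => simp
    | tmul t x => exact Submodule.mul_mem_mul t.2 x.2
    | add x y hx hy => rw [map_add, map_add]; exact Submodule.add_mem _ hx hy
  · intro h
    refine (Submodule.mul_le (P := LinearMap.ker (toFree R hW))).2 (fun t ht w hw => ?_) h
    rw [LinearMap.mem_ker, toFree_mul R hW t ⟨w, hw⟩]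
    have : quot R t = 0 := Ideal.Quotient.eq_zero_iff_mem.2 ((mem_relIdeal R).2 ht)
    rw [this, TensorProduct.zero_tmul]

/-- The degree `n` part of `A ⊗ W`. -/
def freeDeg (hW : W ≤ tensorDeg k V l) (n : ℕ) : Submodule k (Alg R ⊗[k] W) :=
  (⊤ * W ⊓ tensorDeg k V n).map (toFree R hW)

lemma isHomog_top_mul (hW : W ≤ tensorDeg k V l) : IsHomog (⊤ * W) :=
  isHomog_top.mul (isHomog_of_le hW)

lemma freeDeg_isInternal (hW : W ≤ tensorDeg k V l) : DirectSum.IsInternal (freeDeg R hW) := by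
  rw [DirectSum.isInternal_submodule_iff_iSupIndep_and_iSup_eq_top]
  constructor
  · rw [iSupIndep_iff_finsetSum_eq_zero_imp_eq_zero]
    intro s v hv h0 i hi
    choose! x hx hxv using hv
    have h1 : toFree R hW (∑ i ∈ s, x i) = 0 := by
      rw [map_sum, ← h0]
      exact Finset.sum_congr rfl hxv
    rw [toFree_eq_zero_iff R hW (Submodule.sum_mem _ fun i hi => (hx i hi).1)] at h1
    have h2 := (isHomog_relSub R).mul (isHomog_of_le hW) i _ h1
    rw [map_sum, Finset.sum_eq_single_of_mem i hi, proj_of_mem (hx i hi).2] at h2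
    · rw [← hxv i hi]
      exact (toFree_eq_zero_iff R hW (hx i hi).1).2 h2
    · exact fun j hj hji => proj_of_mem_ne (hx j hj).2 hji
  · rw [eq_top_iff]
    rintro p -
    obtain ⟨x, hx, rfl⟩ := toFree_surj R hW p
    obtain ⟨s, hs⟩ := exists_sum_proj x
    rw [hs, map_sum]
    exact Submodule.sum_mem _ fun n _ => Submodule.mem_iSup_of_mem n
      ⟨_, ⟨isHomog_top_mul hW n x hx, proj_mem n x⟩, rfl⟩

lemma smul_mem_freeDeg (hW : W ≤ tensorDeg k V l) {m n : ℕ} {a : Alg R} {p : Alg R ⊗[k] W}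
    (ha : a ∈ algDeg R m) (hp : p ∈ freeDeg R hW n) : a • p ∈ freeDeg R hW (m + n) := by
  obtain ⟨t, ht, rfl⟩ := ha
  obtain ⟨x, ⟨hx, hx'⟩, rfl⟩ := hp
  refine ⟨t * x, ⟨?_, ?_⟩, toFree_mul_mem R hW hx t⟩
  · rw [← top_mul_top_tensorAlgebra, mul_assoc]
    exact Submodule.mul_mem_mul trivial hx
  · rw [← tensorDeg_mul]
    exact Submodule.mul_mem_mul ht hx'

lemma one_tmul_eq_toFree (hW : W ≤ tensorDeg k V l) (x : W) :
    (1 : Alg R) ⊗ₜ[k] x = toFree R hW x := by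
  have := toFree_mul R hW 1 x
  rw [one_mul] at this
  rw [this]
  congr 1

lemma one_tmul_mem_freeDeg (hW : W ≤ tensorDeg k V l) (x : W) :
    (1 : Alg R) ⊗ₜ[k] x ∈ freeDeg R hW l :=
  ⟨x, ⟨le_top_mul _ x.2, hW x.2⟩, (one_tmul_eq_toFree R hW x).symm⟩

variable (W') in
/-- The differential `A ⊗ W' → A ⊗ W` induced by the inclusion `Tens(V) W' ⊆ Tens(V) W`. -/
def freeMap (hW : W ≤ tensorDeg k V l) : Alg R ⊗[k] W' →ₗ[Alg R] Alg R ⊗[k] W :=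
  freeLift R (toFree R hW ∘ₗ W'.subtype)

lemma freeMap_toFree (hW : W ≤ tensorDeg k V l) (hW' : W' ≤ tensorDeg k V l')
    (h : W' ≤ ⊤ * W) {x : TensorAlgebra k V} (hx : x ∈ ⊤ * W') :
    freeMap R W' hW (toFree R hW' x) = toFree R hW x := by
  induction hx using Submodule.mul_induction_on' with
  | mem_mul_mem s hs w hw =>
    rw [toFree_mul R hW' s ⟨w, hw⟩, toFree_mul_mem R hW (h hw)]
    rfl
  | add x hx y hy h h' => rw [map_add, map_add, map_add, h, h']

lemma top_mul_le_top_mul (h : W' ≤ ⊤ * W) : ⊤ * W' ≤ ⊤ * W := by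
  rw [← top_mul_top_tensorAlgebra (k := k) (V := V), mul_assoc ⊤ ⊤ W]
  rw [top_mul_top_tensorAlgebra]
  exact mul_le_mul' le_rfl h

lemma freeMap_mem (hW : W ≤ tensorDeg k V l) (hW' : W' ≤ tensorDeg k V l')
    (h : W' ≤ ⊤ * W) {n : ℕ} {p : Alg R ⊗[k] W'} (hp : p ∈ freeDeg R hW' n) :
    freeMap R W' hW p ∈ freeDeg R hW n := by
  obtain ⟨x, ⟨hx, hx'⟩, rfl⟩ := hp
  exact ⟨x, ⟨top_mul_le_top_mul h hx, hx'⟩, (freeMap_toFree R hW hW' h hx).symm⟩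

/-- Exactness is read off on representatives in the tensor algebra: `hc` says that the composite
vanishes, and `he` is the inclusion of kernel in image, lifted modulo `I W'`. -/
lemma freeMap_exact {W'' : Submodule k (TensorAlgebra k V)} {l'' : ℕ}
    (hW : W ≤ tensorDeg k V l) (hW' : W' ≤ tensorDeg k V l') (hW'' : W'' ≤ tensorDeg k V l'')
    (h : W' ≤ ⊤ * W) (h' : W'' ≤ ⊤ * W') (hc : W'' ≤ relSub R * W)
    (he : ⊤ * W' ⊓ relSub R * W ≤ ⊤ * W'' ⊔ relSub R * W') :
    Function.Exact (freeMap R W'' hW') (freeMap R W' hW) := by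
  intro p
  obtain ⟨x, hx, rfl⟩ := toFree_surj R hW' p
  rw [freeMap_toFree R hW hW' h hx, toFree_eq_zero_iff R hW (top_mul_le_top_mul h hx)]
  constructor
  · intro hx'
    obtain ⟨y, hy, z, hz, rfl⟩ := Submodule.mem_sup.1 (he ⟨hx, hx'⟩)
    refine ⟨toFree R hW'' y, ?_⟩
    rw [freeMap_toFree R hW' hW'' h' hy, map_add,
      (toFree_eq_zero_iff R hW' (mul_le_mul' (le_top (a := relSub R)) (le_refl W') hz)).2 hz, add_zero]
  · rintro ⟨q, hq⟩
    obtain ⟨y, hy, rfl⟩ := toFree_surj R hW'' q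
    rw [freeMap_toFree R hW' hW'' h' hy] at hq
    have h1 : toFree R hW' (x - y) = 0 := by rw [map_sub, hq, sub_self]
    rw [toFree_eq_zero_iff R hW' (Submodule.sub_mem _ hx (top_mul_le_top_mul h' hy))] at h1
    have h2 : y ∈ relSub R * W := by
      have : ⊤ * W'' ≤ relSub R * W := by
        rw [← top_mul_relSub, mul_assoc]; exact mul_le_mul' le_rfl hc
      exact this hy
    have h3 : relSub R * W' ≤ relSub R * W := by
      conv_rhs => rw [← relSub_mul_top, mul_assoc]
      exact mul_le_mul' le_rfl h
    simpa using Submodule.add_mem _ (h3 h1) h2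

/-- `A ⊗ W` is generated in degree `l`, so an element of another degree only has coefficients of
positive degree. -/
lemma freeDeg_le_augIdeal_smul (hW : W ≤ tensorDeg k V l) {n : ℕ} (hn : n ≠ l)
    {p : Alg R ⊗[k] W} (hp : p ∈ freeDeg R hW n) :
    p ∈ augIdeal R • (⊤ : Submodule (Alg R) (Alg R ⊗[k] W)) := by
  obtain ⟨x, hx, rfl⟩ := hp
  rcases lt_or_ge n l with h | h
  · rw [mul_inf_tensorDeg_eq_bot ⊤ hW h] at hx
    rw [(Submodule.mem_bot k).1 hx, map_zero]
    exact Submodule.zero_mem _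
  · obtain ⟨m, rfl⟩ := Nat.exists_eq_add_of_le' h
    have h1 := isHomog_top.mul_inf_tensorDeg_le hW m hx
    clear hx
    induction h1 using Submodule.mul_induction_on' with
    | mem_mul_mem t ht w hw =>
      rw [toFree_mul_mem R hW (le_top_mul _ hw)]
      have h2 : quot R t ∈ augIdeal R := Ideal.subset_span ⟨m, by omega, t, ht.2, rfl⟩
      exact Submodule.smul_mem_smul h2 trivial
    | add x hx y hy h h' => rw [map_add]; exact Submodule.add_mem _ h h'

/-- The map `A ⊗ W → k` induced by the projection `W → k`. -/
def freeAug (W : Submodule k (TensorAlgebra k V)) : Alg R ⊗[k] W →ₗ[Alg R] TrivialModule R :=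
  freeLift R ((Submodule.mkQ (augIdeal R)).restrictScalars k ∘ₗ quot R ∘ₗ W.subtype)

lemma freeAug_toFree (hW : W ≤ tensorDeg k V l) {x : TensorAlgebra k V} (hx : x ∈ ⊤ * W) :
    freeAug R W (toFree R hW x) = Submodule.mkQ (augIdeal R) (quot R x) := by
  induction hx using Submodule.mul_induction_on' with
  | mem_mul_mem s hs w hw =>
    rw [toFree_mul R hW s ⟨w, hw⟩]
    rfl
  | add x hx y hy h h' => simp only [map_add, h, h']

variable (k V) in
/-- The augmentation ideal of the tensor algebra. -/
abbrev tensorAug : Submodule k (TensorAlgebra k V) := ⊤ * tensorDeg k V 1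

lemma tensorDeg_le_tensorAug {n : ℕ} (hn : 1 ≤ n) : tensorDeg k V n ≤ tensorAug k V := by
  obtain ⟨m, rfl⟩ := Nat.exists_eq_add_of_le' hn
  rw [← tensorDeg_mul]
  exact mul_le_mul' le_top le_rfl

lemma top_mul_tensorAug : ⊤ * tensorAug k V = tensorAug k V := by
  rw [← mul_assoc, top_mul_top_tensorAlgebra]

lemma tensorAug_mul_top : tensorAug k V * ⊤ = tensorAug k V := by
  apply le_antisymm
  · rw [← iSup_tensorDeg, Submodule.mul_iSup]
    refine iSup_le fun n => ?_
    rw [mul_assoc, tensorDeg_mul, add_comm, ← tensorDeg_mul, ← mul_assoc]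
    exact mul_le_mul' le_top le_rfl
  · intro x hx
    simpa using Submodule.mul_mem_mul hx
      (Submodule.mem_top (R := k) (x := (1 : TensorAlgebra k V)))

lemma relSub_le_tensorAug (hN : 1 ≤ N) : relSub R ≤ tensorAug k V := by
  rw [relSub, ← tensorAug_mul_top, ← top_mul_tensorAug, mul_assoc, mul_assoc]
  exact mul_le_mul' le_rfl (mul_le_mul' ((relSpace_le R).trans (tensorDeg_le_tensorAug hN)) le_rfl)

lemma quot_mem_augIdeal (hN : 1 ≤ N) {x : TensorAlgebra k V} :
    quot R x ∈ augIdeal R ↔ x ∈ tensorAug k V := by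
  constructor
  · intro hx
    have : ∀ a ∈ augIdeal R, ∃ y ∈ tensorAug k V, quot R y = a := by
      intro a ha
      induction ha using Submodule.span_induction with
      | mem a ha =>
        obtain ⟨n, hn, y, hy, rfl⟩ := ha
        exact ⟨y, tensorDeg_le_tensorAug hn hy, rfl⟩
      | zero => exact ⟨0, Submodule.zero_mem _, map_zero _⟩
      | add a b _ _ ha hb =>
        obtain ⟨y, hy, rfl⟩ := ha
        obtain ⟨z, hz, rfl⟩ := hb
        exact ⟨y + z, Submodule.add_mem _ hy hz, map_add _ _ _⟩
      | smul a b _ hb =>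
        obtain ⟨y, hy, rfl⟩ := hb
        obtain ⟨t, rfl⟩ := Ideal.Quotient.mk_surjective a
        refine ⟨t * y, ?_, map_mul (Ideal.Quotient.mkₐ k (relIdeal R)) t y⟩
        rw [← top_mul_tensorAug]
        exact Submodule.mul_mem_mul trivial hy
    obtain ⟨y, hy, hyx⟩ := this _ hx
    have h1 : x - y ∈ relIdeal R := by
      rw [← Ideal.Quotient.eq_zero_iff_mem]
      have : quot R (x - y) = 0 := by rw [map_sub, hyx, sub_self]
      exact this
    rw [mem_relIdeal] at h1
    simpa using Submodule.add_mem _ (relSub_le_tensorAug R hN h1) hy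
  · intro hx
    refine (Submodule.mul_le (P := ((augIdeal R).restrictScalars k).comap (quot R))).2
      (fun t _ w hw => ?_) hx
    have : quot R (t * w) = quot R t * quot R w :=
      map_mul (Ideal.Quotient.mkₐ k (relIdeal R)) t w
    rw [Submodule.mem_comap, this]
    exact Ideal.mul_mem_left _ _ (Ideal.subset_span ⟨1, le_rfl, w, hw, rfl⟩)

lemma freeMap_freeAug_exact (hN : 1 ≤ N) (hW : W ≤ tensorDeg k V l) (hW1 : 1 ∈ W)
    (hW' : W' = tensorDeg k V 1) :
    Function.Exact (freeMap R W' hW) (freeAug R W) := by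
  have hT : ∀ x, x ∈ ⊤ * W := fun x => by
    simpa using Submodule.mul_mem_mul (Submodule.mem_top (R := k) (x := x)) hW1
  intro p
  obtain ⟨x, hx, rfl⟩ := toFree_surj R hW p
  rw [freeAug_toFree R hW hx, Submodule.mkQ_apply, Submodule.Quotient.mk_eq_zero,
    quot_mem_augIdeal R hN]
  subst hW'
  constructor
  · intro h
    exact ⟨toFree R le_rfl x, freeMap_toFree R hW le_rfl (fun x _ => hT x) h⟩
  · rintro ⟨q, hq⟩
    obtain ⟨y, hy, rfl⟩ := toFree_surj R le_rfl q
    rw [freeMap_toFree R hW le_rfl (fun x _ => hT x) hy] at hq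
    have h1 : toFree R hW (x - y) = 0 := by rw [map_sub, hq, sub_self]
    rw [toFree_eq_zero_iff R hW (hT _)] at h1
    have h2 : relSub R * W ≤ tensorAug k V :=
      (mul_le_mul' (relSub_le_tensorAug R hN) le_top).trans tensorAug_mul_top.le
    simpa using Submodule.add_mem _ (h2 h1) hy

/-- The resolution of `k` by the modules `A ⊗ W_i`. -/
def freeResolution (hN : 1 ≤ N) (W : ℕ → Submodule k (TensorAlgebra k V)) (l : ℕ → ℕ)
    (hW : ∀ i, W i ≤ tensorDeg k V (l i)) (hW0 : 1 ∈ W 0)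
    (hW1 : W 1 = tensorDeg k V 1) (hstep : ∀ i, W (i + 1) ≤ ⊤ * W i)
    (hcomp : ∀ i, W (i + 2) ≤ relSub R * W i)
    (hex : ∀ i, ⊤ * W (i + 1) ⊓ relSub R * W i ≤ ⊤ * W (i + 2) ⊔ relSub R * W (i + 1)) :
    GradedFreeResolution R where
  P i := Alg R ⊗[k] W i
  deg i := freeDeg R (hW i)
  isInternal i := freeDeg_isInternal R (hW i)
  smul_mem i m n a x ha hx := smul_mem_freeDeg R (hW i) ha hx
  ι i := Module.Basis.ofVectorSpaceIndex k (W i)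
  basis i := Algebra.TensorProduct.basis (Alg R) (Module.Basis.ofVectorSpace k (W i))
  basis_mem i b := ⟨l i, by
    rw [Algebra.TensorProduct.basis_apply]
    exact one_tmul_mem_freeDeg R (hW i) _⟩
  d i := freeMap R (W (i + 1)) (hW i)
  d_mem i n x hx := freeMap_mem R (hW i) (hW (i + 1)) (hstep i) hx
  aug := freeAug R (W 0)
  aug_eq_zero n x hn hx := by
    obtain ⟨y, ⟨hy, hy'⟩, rfl⟩ := hx
    rw [freeAug_toFree R (hW 0) hy, Submodule.mkQ_apply, Submodule.Quotient.mk_eq_zero,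
      quot_mem_augIdeal R hN]
    exact tensorDeg_le_tensorAug hn hy'
  aug_surjective a := by
    obtain ⟨a, rfl⟩ := Submodule.mkQ_surjective _ a
    obtain ⟨t, rfl⟩ := Ideal.Quotient.mk_surjective a
    have ht : t ∈ ⊤ * W 0 := by
      simpa using Submodule.mul_mem_mul (Submodule.mem_top (R := k) (x := t)) hW0
    exact ⟨toFree R (hW 0) t, freeAug_toFree R (hW 0) ht⟩
  exact_zero := freeMap_freeAug_exact R hN (hW 0) hW0 hW1
  exact_succ i := freeMap_exact R (hW i) (hW (i + 1)) (hW (i + 2)) (hstep i) (hstep (i + 1))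
    (hcomp i) (hex i)

/-- The term `A ⊗ W i` has all its generators in degree `l i`, so `k ⊗_A P_i` already vanishes in
the other degrees. -/
lemma freeResolution_tor (hN : 1 ≤ N) (W : ℕ → Submodule k (TensorAlgebra k V)) (l : ℕ → ℕ)
    (hW : ∀ i, W i ≤ tensorDeg k V (l i)) (hW0 : 1 ∈ W 0)
    (hW1 : W 1 = tensorDeg k V 1) (hstep : ∀ i, W (i + 1) ≤ ⊤ * W i)
    (hcomp : ∀ i, W (i + 2) ≤ relSub R * W i)
    (hex : ∀ i, ⊤ * W (i + 1) ⊓ relSub R * W i ≤ ⊤ * W (i + 2) ⊔ relSub R * W (i + 1))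
    {i n : ℕ} (hn : n ≠ l i) :
    Subsingleton ((freeResolution R hN W l hW hW0 hW1 hstep hcomp hex).Tor i n) := by
  set F := freeResolution R hN W l hW hW0 hW1 hstep hcomp hex with hF
  have h1 : F.coinvDeg i n = ⊥ := by
    rw [eq_bot_iff]
    rintro _ ⟨x, hx, rfl⟩
    exact (Submodule.Quotient.mk_eq_zero _).2 (freeDeg_le_augIdeal_smul R (hW i) hn hx)
  have h2 : F.cycles i n = ⊥ := by
    rw [eq_bot_iff, ← h1]
    cases i with
    | zero => exact le_rfl
    | succ i => exact inf_le_left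
  rw [Submodule.Quotient.subsingleton_iff, eq_top_iff]
  rintro ⟨x, hx⟩ -
  rw [h2, Submodule.mem_bot] at hx
  subst hx
  exact Submodule.zero_mem _

end FreeModules

/-! ### Distributive families of subspaces and adapted bases. -/

section Distributive

variable {α ι : Type*} [Lattice α]

lemma inf_finset_sup_le [OrderBot α] {L : Set α} (hL : IsSublattice L)
    (hD : ∀ X ∈ L, ∀ Y ∈ L, ∀ Z ∈ L, X ⊓ (Y ⊔ Z) = (X ⊓ Y) ⊔ (X ⊓ Z)) {X : α} (hX : X ∈ L)
    (t : Finset ι) {Y : ι → α} (hY : ∀ i ∈ t, Y i ∈ L) :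
    X ⊓ t.sup Y ≤ t.sup fun i => X ⊓ Y i := by
  classical
  induction t using Finset.induction with
  | empty => simp
  | insert a t ha ih =>
    rw [Finset.sup_insert, Finset.sup_insert]
    have ih' := ih fun i hi => hY i (Finset.mem_insert_of_mem hi)
    -- The empty supremum `⊥` need not belong to `L`, so distributivity can only be applied to a
    -- nonempty `t`.
    rcases t.eq_empty_or_nonempty with rfl | ht
    · simp
    · rw [hD X hX _ (hY a (Finset.mem_insert_self a t)) _ (hL.supClosed.finsetSup_mem ht
        fun i hi => hY i (Finset.mem_insert_of_mem hi))]
      exact sup_le_sup le_rfl ih'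

end Distributive

section AdaptedBasis

variable {k : Type*} {M : Type u} [Field k] [AddCommGroup M] [Module k M] {ι : Type} [Fintype ι]

open Classical in
/-- A finite family of subspaces that generates a distributive lattice has an adapted basis. -/
theorem exists_adapted_basis (R : ι → Submodule k M)
    (hD : ∀ X ∈ latticeClosure (Set.range R), ∀ Y ∈ latticeClosure (Set.range R),
      ∀ Z ∈ latticeClosure (Set.range R), X ⊓ (Y ⊔ Z) = (X ⊓ Y) ⊔ (X ⊓ Z)) :
    ∃ (κ : Type u) (b : Module.Basis κ k M) (B : ι → Set κ),
      ∀ a, R a = Submodule.span k (b '' B a) := by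
  have hL := isSublattice_latticeClosure (s := Set.range R)
  have hmem : ∀ s : Finset ι, s.Nonempty → s.inf R ∈ latticeClosure (Set.range R) := fun s hs =>
    hL.infClosed.finsetInf_mem hs fun i _ => subset_latticeClosure ⟨i, rfl⟩
  -- With `R_s = s.inf R`, `U s` is the sum of the `R_t` over `t ⊋ s`, and `C s` will be a
  -- complement of it in `R_s`. The `C s` decompose `M`, and `R a` is the sum of the `C s` with `a ∈
  -- s`.
  let U : Finset ι → Submodule k M := fun s => (Finset.univ.filter (s ⊂ ·)).sup fun t => t.inf R
  have hU : ∀ s, U s ≤ s.inf R := fun s => Finset.sup_le fun t ht =>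
    Finset.inf_mono (Finset.mem_filter.1 ht).2.subset
  have hC : ∀ s, ∃ C : Submodule k M, C ⊔ U s = s.inf R ∧ C ⊓ U s = ⊥ := by
    intro s
    obtain ⟨C, hC⟩ := (U s).exists_isCompl
    refine ⟨C ⊓ s.inf R, ?_, ?_⟩
    · rw [inf_comm, inf_sup_assoc_of_le _ (hU s), sup_comm, hC.sup_eq_top, inf_top_eq]
    · rw [eq_bot_iff, ← hC.inf_eq_bot]
      exact le_inf inf_le_right (inf_le_left.trans inf_le_left)
  choose C hC1 hC2 using hC
  have hCR : ∀ s, C s ≤ s.inf R := fun s => le_sup_left.trans (hC1 s).le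
  have hspan : ∀ s : Finset ι, s.inf R = ⨆ t, ⨆ (_ : s ⊆ t), C t := by
    intro s
    induction s using WellFoundedGT.induction with
    | ind s ih =>
      apply le_antisymm
      · rw [← hC1 s]
        refine sup_le (le_iSup₂_of_le (f := fun t (_ : s ⊆ t) => C t) s subset_rfl le_rfl)
          (Finset.sup_le fun t ht => ?_)
        have hst := (Finset.mem_filter.1 ht).2
        rw [ih t hst]
        exact iSup₂_le fun r hr =>
          le_iSup₂_of_le (f := fun t (_ : s ⊆ t) => C t) r (hst.subset.trans hr) le_rfl
      · exact iSup₂_le fun t ht => (hCR t).trans (Finset.inf_mono ht)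
  have hindep : iSupIndep C := by
    rw [iSupIndep_iff_finsetSum_eq_zero_imp_eq_zero]
    intro S v hv h0
    by_contra! hne
    -- Take `s` minimal among the indices of nonzero terms. Every other such `t` is not contained in
    -- `s`, so `R_s ∩ R_t = R_{s ∪ t}` lies in `U s`; by distributivity `v s ∈ C s ∩ U s = 0`.
    obtain ⟨s, hs, hmin⟩ := (S.filter (v · ≠ 0)).exists_minimal
      (by obtain ⟨i, hi, hi'⟩ := hne; exact ⟨i, Finset.mem_filter.2 ⟨hi, hi'⟩⟩)
    rw [Finset.mem_filter] at hs
    have h1 : v s = -∑ t ∈ (S.filter (v · ≠ 0)).erase s, v t := by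
      rw [← Finset.sum_filter_ne_zero, ← Finset.add_sum_erase _ _ (Finset.mem_filter.2 hs)] at h0
      exact eq_neg_of_add_eq_zero_left h0
    have h2 : v s ∈ ((S.filter (v · ≠ 0)).erase s).sup fun t => t.inf R := by
      rw [h1]
      refine Submodule.neg_mem _ (Submodule.sum_mem _ fun t ht => ?_)
      exact Finset.le_sup (f := fun t : Finset ι => t.inf R) ht
        (hCR t (hv t (Finset.mem_filter.1 (Finset.mem_of_mem_erase ht)).1))
    have hns : ∀ t ∈ (S.filter (v · ≠ 0)).erase s, ¬ t ⊆ s := fun t ht hts =>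
      (Finset.mem_erase.1 ht).1 (subset_antisymm hts (hmin (Finset.mem_of_mem_erase ht) hts))
    have h3 : s.inf R ⊓ ((S.filter (v · ≠ 0)).erase s).sup (fun t => t.inf R) ≤
        ((S.filter (v · ≠ 0)).erase s).sup fun t => s.inf R ⊓ t.inf R := by
      -- For `s = ∅` the infimum is `⊤`, possibly outside the generated lattice, but then the
      -- inclusion is trivial.
      rcases s.eq_empty_or_nonempty with hse | hse
      · simp [hse]
      · refine inf_finset_sup_le hL hD (hmem s hse) _ fun t ht => hmem t ?_
        rw [Finset.nonempty_iff_ne_empty]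
        rintro rfl
        exact hns _ ht (Finset.empty_subset _)
    have h4 : ((S.filter (v · ≠ 0)).erase s).sup (fun t => s.inf R ⊓ t.inf R) ≤ U s := by
      refine Finset.sup_le fun t ht => ?_
      rw [← Finset.inf_union]
      refine Finset.le_sup (f := fun t : Finset ι => t.inf R) (Finset.mem_filter.2
        ⟨Finset.mem_univ _, Finset.subset_union_left, fun h => hns t ht ?_⟩)
      exact Finset.subset_union_right.trans h
    have h5 : v s ∈ C s ⊓ U s := ⟨hv s hs.1, h4 (h3 ⟨hCR s (hv s hs.1), h2⟩)⟩
    rw [hC2, Submodule.mem_bot] at h5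
    exact hs.2 h5
  have htop : iSup C = ⊤ := by simpa using (hspan ∅).symm
  have hint := DirectSum.isInternal_submodule_of_iSupIndep_of_iSup_eq_top hindep htop
  obtain ⟨K, ⟨bas⟩⟩ : ∃ K : Finset ι → Type u, Nonempty (∀ s, Module.Basis (K s) k (C s)) :=
    ⟨_, ⟨fun s => Module.Basis.ofVectorSpace k (C s)⟩⟩
  have hb : ∀ t j, hint.collectedBasis bas ⟨t, j⟩ = (bas t j : M) := fun t j => by
    rw [DirectSum.IsInternal.collectedBasis_coe]
  refine ⟨_, hint.collectedBasis bas, fun a => {p | a ∈ p.1}, fun a => ?_⟩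
  generalize hint.collectedBasis bas = b at hb ⊢
  have ha := hspan {a}
  rw [Finset.inf_singleton] at ha
  rw [ha]
  apply le_antisymm
  · refine iSup₂_le fun t ht => ?_
    have : C t = Submodule.span k ((C t).subtype '' Set.range (bas t)) := by
      rw [← Submodule.map_span, Module.Basis.span_eq, Submodule.map_subtype_top]
    rw [this]
    refine Submodule.span_mono ?_
    rintro _ ⟨_, ⟨j, rfl⟩, rfl⟩
    rw [Submodule.subtype_apply, ← hb t j]
    exact Set.mem_image_of_mem b (Finset.singleton_subset_iff.1 ht)
  · rw [Submodule.span_le]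
    rintro _ ⟨⟨t, j⟩, ht, rfl⟩
    have h : C t ≤ ⨆ t, ⨆ (_ : {a} ⊆ t), C t :=
      le_iSup₂_of_le t (Finset.singleton_subset_iff.2 ht) le_rfl
    rw [SetLike.mem_coe, hb]
    exact h (bas t j).2

end AdaptedBasis

/-! ### The embedding of the tensor algebra of `V ⊗ V'` and the Manin relations. -/

section Tensor

variable {k : Type*} [Field k] {A B : Type*} [Ring A] [Algebra k A] [Ring B] [Algebra k B]

lemma tens_mul_tens (P P' : Submodule k A) (Q Q' : Submodule k B) :
    tens P Q * tens P' Q' = tens (P * P') (Q * Q') := by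
  rw [tens, tens, tens, Submodule.map₂_eq_span_image2, Submodule.map₂_eq_span_image2,
    Submodule.span_mul_span]
  apply le_antisymm
  · rw [Submodule.span_le]
    rintro _ ⟨_, ⟨p, hp, q, hq, rfl⟩, _, ⟨p', hp', q', hq', rfl⟩, rfl⟩
    simp only [TensorProduct.mk_apply, Algebra.TensorProduct.tmul_mul_tmul]
    exact Submodule.apply_mem_map₂ _ (Submodule.mul_mem_mul hp hp') (Submodule.mul_mem_mul hq hq')
  · refine Submodule.map₂_le.2 fun m hm n hn => ?_
    rw [TensorProduct.mk_apply]
    induction hm using Submodule.mul_induction_on' with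
    | mem_mul_mem p hp p' hp' =>
      induction hn using Submodule.mul_induction_on' with
      | mem_mul_mem q hq q' hq' =>
        rw [← Algebra.TensorProduct.tmul_mul_tmul]
        exact Submodule.subset_span ⟨_, ⟨p, hp, q, hq, rfl⟩, _, ⟨p', hp', q', hq', rfl⟩, rfl⟩
      | add x _ y _ hx hy => rw [TensorProduct.tmul_add]; exact Submodule.add_mem _ hx hy
    | add x _ y _ hx hy => rw [TensorProduct.add_tmul]; exact Submodule.add_mem _ hx hy

lemma tens_one_one : tens (1 : Submodule k A) (1 : Submodule k B) = 1 := by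
  rw [tens, Submodule.one_eq_span, Submodule.one_eq_span, Submodule.map₂_span_span,
    Set.image2_singleton, Submodule.one_eq_span]
  rfl

lemma tens_pow (P : Submodule k A) (Q : Submodule k B) (n : ℕ) :
    tens P Q ^ n = tens (P ^ n) (Q ^ n) := by
  induction n with
  | zero => simp only [pow_zero, tens_one_one]
  | succ n ih => rw [pow_succ, ih, tens_mul_tens, pow_succ, pow_succ]

end Tensor

section Manin

variable {k : Type u} {V : Type v} {V' : Type w} [Field k] [AddCommGroup V] [Module k V]
  [AddCommGroup V'] [Module k V'] {N : ℕ}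

variable (k V V') in
/-- The algebra map `Tens(V ⊗ V') → Tens(V) ⊗ Tens(V')` which identifies `(V ⊗ V')^{⊗ n}` with
`V^{⊗ n} ⊗ V'^{⊗ n}`. -/
def segre : TensorAlgebra k (V ⊗[k] V') →ₐ[k] TensorAlgebra k V ⊗[k] TensorAlgebra k V' :=
  TensorAlgebra.lift k (TensorProduct.map (TensorAlgebra.ι k) (TensorAlgebra.ι k))

@[simp] lemma segre_ι_tmul (x : V) (y : V') :
    segre k V V' (TensorAlgebra.ι k (x ⊗ₜ y)) = TensorAlgebra.ι k x ⊗ₜ TensorAlgebra.ι k y := by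
  simp [segre]

lemma segre_basis {κ κ' : Type*} (b : Module.Basis κ k V) (b' : Module.Basis κ' k V')
    (z : FreeMonoid (κ × κ')) : segre k V V' ((b.tensorProduct b').tensorAlgebra z) =
      b.tensorAlgebra (FreeMonoid.map Prod.fst z) ⊗ₜ
        b'.tensorAlgebra (FreeMonoid.map Prod.snd z) := by
  simp only [basis_tensorAlgebra_apply]
  induction z using FreeMonoid.inductionOn' with
  | one => simp [Algebra.TensorProduct.one_def]
  | of_mul p z ih =>
    rw [map_mul, map_mul, map_mul, map_mul, map_mul, map_mul, ih, FreeMonoid.lift_eval_of,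
      Module.Basis.tensorProduct_apply', segre_ι_tmul]
    simp

/-- A word in pairs of letters is determined by its two component words. -/
lemma segre_injective : Function.Injective (segre k V V') := by
  let b := Module.Basis.ofVectorSpace k V
  let b' := Module.Basis.ofVectorSpace k V'
  have := injOn_span_basis (b.tensorProduct b').tensorAlgebra
    (b.tensorAlgebra.tensorProduct b'.tensorAlgebra) (segre k V V').toLinearMap
    (fun z => (FreeMonoid.map Prod.fst z, FreeMonoid.map Prod.snd z))
    (fun z => by rw [Module.Basis.tensorProduct_apply']; exact segre_basis b b' z)
    (s := Set.univ) ?_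
  · simpa [Module.Basis.span_eq, Set.injOn_univ] using this
  · intro z _ z' _ h
    simp only [Prod.mk.injEq] at h
    have h1 : z.toList.map Prod.fst = z'.toList.map Prod.fst := h.1
    have h2 : z.toList.map Prod.snd = z'.toList.map Prod.snd := h.2
    apply FreeMonoid.toList.injective
    rw [← List.zip_unzip z.toList, ← List.zip_unzip z'.toList]
    simp only [List.unzip_fst, List.unzip_snd, h1, h2]

lemma map_segre_tensorDeg (n : ℕ) :
    (tensorDeg k (V ⊗[k] V') n).map (segre k V V').toLinearMap =
      tens (tensorDeg k V n) (tensorDeg k V' n) := by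
  rw [tensorDeg, Submodule.map_pow, tensorDeg, tensorDeg, ← tens_pow]
  congr 1
  rw [← LinearMap.range_comp]
  have : (segre k V V').toLinearMap ∘ₗ TensorAlgebra.ι k =
      TensorProduct.map (TensorAlgebra.ι k) (TensorAlgebra.ι k) := by
    ext; simp
  rw [this, TensorProduct.range_map]

lemma segre_toTensorAlgebra (n : ℕ) (r : ⨂[k]^n V) (r' : ⨂[k]^n V') :
    segre k V V' (TensorPower.toTensorAlgebra
      (PiTensorProduct.map₂ (fun _ => TensorProduct.mk k V V') r r')) =
      TensorPower.toTensorAlgebra r ⊗ₜ TensorPower.toTensorAlgebra r' := by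
  have key : ((PiTensorProduct.map₂ (fun _ : Fin n => TensorProduct.mk k V V')).compr₂
      TensorPower.toTensorAlgebra).compr₂ (segre k V V').toLinearMap =
      (TensorProduct.mk k _ _).compl₁₂ TensorPower.toTensorAlgebra
        TensorPower.toTensorAlgebra := by
    ext x y
    simp only [LinearMap.compMultilinearMap_apply, LinearMap.compr₂_apply,
      PiTensorProduct.map₂_tprod_tprod, TensorPower.toTensorAlgebra_tprod,
      TensorAlgebra.tprod_apply, AlgHom.toLinearMap_apply, TensorProduct.mk_apply,
      LinearMap.compl₁₂_apply, map_list_prod, List.map_ofFn]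
    clear r r'
    induction n with
    | zero => simp [Algebra.TensorProduct.one_def]
    | succ n ih =>
      simp only [List.ofFn_succ, List.prod_cons, Function.comp_apply, segre_ι_tmul]
      rw [← Algebra.TensorProduct.tmul_mul_tmul, ← ih]
      simp only [Function.comp_def, segre_ι_tmul]
  exact LinearMap.congr_fun₂ key r r'

variable (R : Submodule k (⨂[k]^N V)) (R' : Submodule k (⨂[k]^N V'))

lemma map_segre_relSpace : (relSpace (maninRel R R')).map (segre k V V').toLinearMap =
    tens (relSpace R) (relSpace R') := by
  rw [relSpace, maninRel, Submodule.map_map₂, Submodule.map_map₂, relSpace, relSpace, tens,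
    Submodule.map₂_map_map]
  congr 1
  refine LinearMap.ext₂ fun r r' => ?_
  exact segre_toTensorAlgebra N r r'

lemma map_segre_relAt (i j : ℕ) : (relAt (maninRel R R') i j).map (segre k V V').toLinearMap =
    tens (relAt R i j) (relAt R' i j) := by
  rw [relAt, Submodule.map_mul, Submodule.map_mul, map_segre_relSpace, map_segre_tensorDeg,
    map_segre_tensorDeg, tens_mul_tens, tens_mul_tens]
  rfl

end Manin

/-! ### Passage of distributivity and of the extra condition to the Manin product. -/

section Properties

variable {k : Type u} {V : Type v} {V' : Type w} [Field k] [AddCommGroup V] [Module k V]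
  [AddCommGroup V'] [Module k V'] {N : ℕ}

/-- The subspace `V^{⊗ a} ⊗ R ⊗ V^{⊗ (n - N - a)}` of `V^{⊗ n}`. -/
abbrev relIn (R : Submodule k (⨂[k]^N V)) (n a : ℕ) : Submodule k (TensorAlgebra k V) :=
  relAt R a (n - N - a)

/-- Intersections of the subspaces `V^{⊗ i} ⊗ R ⊗ V^{⊗ j}` of `V^{⊗ n}` distribute over their
sums. -/
def InfDistrib (R : Submodule k (⨂[k]^N V)) : Prop :=
  ∀ (n : ℕ) (s t : Finset ℕ), (∀ a ∈ s, a + N ≤ n) → (∀ a ∈ t, a + N ≤ n) →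
    s.inf (relIn R n) ⊓ t.sup (relIn R n) ≤ t.sup fun a => s.inf (relIn R n) ⊓ relIn R n a

/-- The extra condition of Berger. -/
def ExtraCondition (R : Submodule k (⨂[k]^N V)) : Prop :=
  ∀ m : ℕ, 1 ≤ m → m + 1 < N → relAt R (m + 1) 0 ⊓ relAt R 0 (m + 1) ≤ relAt R m 1

lemma IsDistributive.exists_basis {R : Submodule k (⨂[k]^N V)} (h : IsDistributive R) (n : ℕ) :
    ∃ (κ : Type (max u v)) (b : Module.Basis κ k (TensorAlgebra k V)) (B : ℕ → Set κ),
      ∀ a, a + N ≤ n → relIn R n a = Submodule.span k (b '' B a) := by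
  rcases lt_or_ge n N with hn | hn
  · refine ⟨_, Module.Basis.ofVectorSpace k _, fun _ => ∅, fun a ha => by omega⟩
  · have hr : Set.range (fun a : Fin (n + 1 - N) => relIn R n a) =
        {Y | ∃ i j : ℕ, i + j + N = n ∧ Y = relAt R i j} := by
      ext Y
      constructor
      · rintro ⟨⟨a, ha⟩, rfl⟩
        exact ⟨a, n - N - a, by omega, rfl⟩
      · rintro ⟨i, j, hij, rfl⟩
        refine ⟨⟨i, by omega⟩, ?_⟩
        simp only [relIn]
        congr 1
        omega
    obtain ⟨κ, b, B, hB⟩ := exists_adapted_basis (fun a : Fin (n + 1 - N) => relIn R n a)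
      (by rw [hr]; exact h n hn)
    refine ⟨κ, b, fun a => if h : a < n + 1 - N then B ⟨a, h⟩ else ∅, fun a ha => ?_⟩
    have ha' : a < n + 1 - N := by omega
    simp only [dif_pos ha']
    exact hB ⟨a, ha'⟩

/-- In the tensor product of adapted bases each relation subspace becomes the span of the basis
vectors indexed by `B a ×ˢ B' a`, and spans of parts of one basis intersect and add like sets. -/
lemma infDistrib_maninRel {R : Submodule k (⨂[k]^N V)} {R' : Submodule k (⨂[k]^N V')}
    (h : IsDistributive R) (h' : IsDistributive R') : InfDistrib (maninRel R R') := by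
  intro n s t hs ht
  obtain ⟨κ, b, B, hB⟩ := h.exists_basis n
  obtain ⟨κ', b', B', hB'⟩ := h'.exists_basis n
  set β := b.tensorProduct b'
  set f := (segre k V V').toLinearMap
  have hf : Function.Injective f := segre_injective
  let E : ℕ → Set (κ × κ') := fun a => B a ×ˢ B' a
  have hE : ∀ a, a + N ≤ n → (relIn (maninRel R R') n a).map f = Submodule.span k (β '' E a) := by
    intro a ha
    rw [map_segre_relAt, ← tens_span_basis, ← hB a ha, ← hB' a ha]
  let X : Submodule k _ := Submodule.span k (β '' ⋂ a ∈ s, E a)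
  have hX : X.comap f ≤ s.inf (relIn (maninRel R R') n) := by
    refine Finset.le_inf fun a ha => ?_
    rw [← Submodule.comap_map_eq_of_injective hf (relIn (maninRel R R') n a), hE a (hs a ha)]
    exact Submodule.comap_mono (Submodule.span_mono (Set.image_mono (Set.biInter_subset_of_mem ha)))
  rintro x ⟨hx, hx'⟩
  have h1 : f x ∈ X := by
    rw [β.mem_span_image, Set.subset_iInter₂_iff]
    intro a ha
    rw [← β.mem_span_image, ← hE a (hs a ha)]
    exact Submodule.mem_map_of_mem (Finset.inf_le (f := relIn (maninRel R R') n) ha hx)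
  have h2 : f x ∈ Submodule.span k (β '' ⋃ a ∈ t, E a) := by
    have : t.sup (relIn (maninRel R R') n) ≤
        (Submodule.span k (β '' ⋃ a ∈ t, E a)).comap f := by
      refine Finset.sup_le fun a ha => ?_
      rw [← Submodule.map_le_iff_le_comap, hE a (ht a ha)]
      exact Submodule.span_mono (Set.image_mono (Set.subset_biUnion_of_mem ha))
    exact this hx'
  have h3 : f x ∈ Submodule.span k (β '' ((⋂ a ∈ s, E a) ∩ ⋃ a ∈ t, E a)) := by
    rw [← span_basis_image_inf]
    exact ⟨h1, h2⟩
  have h4 : Submodule.span k (β '' ((⋂ a ∈ s, E a) ∩ ⋃ a ∈ t, E a)) ≤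
      (t.sup fun a => s.inf (relIn (maninRel R R') n) ⊓ relIn (maninRel R R') n a).map f := by
    rw [Submodule.span_le]
    rintro _ ⟨e, ⟨he, he'⟩, rfl⟩
    obtain ⟨a, ha, hea⟩ := Set.mem_iUnion₂.1 he'
    have h5 : β e ∈ (relIn (maninRel R R') n a).map f := by
      rw [hE a (ht a ha)]
      exact Submodule.subset_span ⟨e, hea, rfl⟩
    -- A basis vector `β e` need not lie in the range of `f`, and `s` may be empty; membership of
    -- `e` in some `E a` with `a ∈ t` supplies the preimage.
    obtain ⟨y, hy, hye⟩ := h5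
    refine ⟨y, ?_, hye⟩
    refine Finset.le_sup (f := fun a => s.inf (relIn (maninRel R R') n) ⊓
      relIn (maninRel R R') n a) ha ⟨hX ?_, hy⟩
    rw [Submodule.mem_comap, hye]
    exact Submodule.subset_span ⟨e, he, rfl⟩
  obtain ⟨y, hy, hyx⟩ := h4 h3
  rwa [← hf hyx]

lemma extraCondition_maninRel {R : Submodule k (⨂[k]^N V)} {R' : Submodule k (⨂[k]^N V')}
    (h : ExtraCondition R) (h' : ExtraCondition R') : ExtraCondition (maninRel R R') := by
  intro m hm hm'
  have hf : Function.Injective (segre k V V').toLinearMap := segre_injective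
  rw [← Submodule.map_le_map_iff_of_injective hf, map_segre_relAt]
  refine (Submodule.map_inf_le _).trans ?_
  rw [map_segre_relAt, map_segre_relAt, tens_inf_tens]
  exact Submodule.map₂_le_map₂ (h m hm hm') (h' m hm hm')

end Properties

/-! ### Exactness of the Koszul complex. -/

section KoszulComplex

variable {k : Type u} {V : Type v} [Field k] [AddCommGroup V] [Module k V] {N : ℕ}
  (R : Submodule k (⨂[k]^N V))

lemma relIn_le {n a : ℕ} (h : a + N ≤ n) : relIn R n a ≤ tensorDeg k V n := by
  have := relAt_le R a (n - N - a)
  rwa [show a + N + (n - N - a) = n by omega] at this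

lemma tensorDeg_mul_relIn (m : ℕ) {n a : ℕ} (h : a + N ≤ n) :
    tensorDeg k V m * relIn R n a = relIn R (m + n) (m + a) := by
  rw [relIn, tensorDeg_mul_relAt, relIn]
  congr 1
  omega

lemma relIn_mul_tensorDeg (m : ℕ) {n a : ℕ} (h : a + N ≤ n) :
    relIn R n a * tensorDeg k V m = relIn R (n + m) a := by
  rw [relIn, relAt_mul_tensorDeg, relIn]
  congr 1
  omega

lemma tensorDeg_mul_inf {ι : Type*} (m n : ℕ) (s : Finset ι)
    (S : ι → Submodule k (TensorAlgebra k V)) (hS : ∀ a ∈ s, S a ≤ tensorDeg k V n) :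
    tensorDeg k V m * (tensorDeg k V n ⊓ s.inf S) =
      tensorDeg k V (m + n) ⊓ s.inf fun a => tensorDeg k V m * S a := by
  classical
  induction s using Finset.induction with
  | empty => simp [tensorDeg_mul]
  | insert a s ha ih =>
    rw [Finset.inf_insert, Finset.inf_insert, inf_left_comm, inf_left_comm (tensorDeg k V (m + n)),
      ← ih fun b hb => hS b (Finset.mem_insert_of_mem hb),
      mul_inf_mul _ _ (hS a (Finset.mem_insert_self a s)) inf_le_left, inf_idem]

/-- The intersection of all the `V^{⊗ i} ⊗ R ⊗ V^{⊗ j}` in `V^{⊗ n}`. -/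
def relInter (n : ℕ) : Submodule k (TensorAlgebra k V) :=
  tensorDeg k V n ⊓ (Finset.range (n + 1 - N)).inf (relIn R n)

lemma relInter_le (n : ℕ) : relInter R n ≤ tensorDeg k V n := inf_le_left

lemma relInter_le_relIn {n a : ℕ} (h : a + N ≤ n) : relInter R n ≤ relIn R n a :=
  inf_le_right.trans (Finset.inf_le (Finset.mem_range.2 (by omega)))

/-- No relation fits in degree `n < N`; the factor `tensorDeg k V n` makes the empty intersection
`V^{⊗ n}` rather than the whole tensor algebra. -/
lemma relInter_eq_tensorDeg {n : ℕ} (h : n < N) : relInter R n = tensorDeg k V n := by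
  rw [relInter, show n + 1 - N = 0 by omega]
  simp

lemma tensorDeg_mul_relInter (m n : ℕ) : tensorDeg k V m * relInter R n =
    tensorDeg k V (m + n) ⊓ (Finset.Ico m (m + n + 1 - N)).inf (relIn R (m + n)) := by
  rw [relInter, tensorDeg_mul_inf _ _ _ _ fun a ha =>
    relIn_le R (by have := Finset.mem_range.1 ha; omega)]
  congr 1
  apply le_antisymm
  · refine Finset.le_inf fun c hc => ?_
    rw [Finset.mem_Ico] at hc
    obtain ⟨a, rfl⟩ := Nat.exists_eq_add_of_le hc.1
    rw [← tensorDeg_mul_relIn R m (by omega)]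
    exact Finset.inf_le (f := fun a => tensorDeg k V m * relIn R n a)
      (Finset.mem_range.2 (by omega))
  · refine Finset.le_inf fun a ha => ?_
    rw [Finset.mem_range] at ha
    rw [tensorDeg_mul_relIn R m (by omega)]
    exact Finset.inf_le (Finset.mem_Ico.2 (by omega))

lemma relInter_add_le (m n : ℕ) : relInter R (m + n) ≤ tensorDeg k V m * relInter R n := by
  rw [tensorDeg_mul_relInter]
  exact le_inf (relInter_le R _) (Finset.le_inf fun a ha =>
    relInter_le_relIn R (by have := Finset.mem_Ico.1 ha; omega))

/-- The space `W_{N+n}` lies both in `R ⊗ V^{⊗ n}` and in `V^{⊗ N} ⊗ W_n`, which meet in `R ⊗ W_n`.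
This makes the square of the Koszul differential vanish. -/
lemma relInter_add_le_relSub (n : ℕ) : relInter R (N + n) ≤ relSub R * relInter R n := by
  have h1 : relInter R (N + n) ≤ relSpace R * tensorDeg k V n := by
    refine (relInter_le_relIn R (a := 0) (by omega)).trans ?_
    rw [relIn, relAt, tensorDeg_zero, one_mul, show N + n - N - 0 = n by omega]
  refine (le_inf h1 (relInter_add_le R N n)).trans ?_
  rw [mul_inf_mul _ _ le_rfl (relInter_le R n)]
  exact mul_le_mul' (inf_le_left.trans (relSpace_le_relSub R)) inf_le_right

variable {R}

/-- Induction on the shift: the extra condition supplies the position next to the last one, after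
which a factor `V` splits off on the right. -/
lemma ExtraCondition.relAt_inf_le (h : ExtraCondition R) {m : ℕ} (hm : m < N) {c : ℕ}
    (hc : c ≤ m) : relAt R m 0 ⊓ relAt R 0 m ≤ relAt R c (m - c) := by
  induction m generalizing c with
  | zero =>
    obtain rfl : c = 0 := by omega
    exact inf_le_left
  | succ m ih =>
    rcases Nat.lt_or_ge m c with hcm | hcm
    · obtain rfl : c = m + 1 := by omega
      rw [Nat.sub_self]
      exact inf_le_left
    · rcases Nat.eq_zero_or_pos m with rfl | hm0
      · obtain rfl : c = 0 := by omega
        exact inf_le_right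
      · have h1 : relAt R (m + 1) 0 ⊓ relAt R 0 (m + 1) ≤ relAt R m 0 * tensorDeg k V 1 ⊓
            relAt R 0 m * tensorDeg k V 1 := by
          rw [relAt_mul_tensorDeg, relAt_mul_tensorDeg]
          exact le_inf (h m hm0 hm) inf_le_right
        refine h1.trans ?_
        rw [mul_inf_mul _ _ le_rfl le_rfl, inf_idem, Nat.sub_add_comm hcm, ← relAt_mul_tensorDeg]
        exact mul_le_mul' (ih (by omega) hcm) le_rfl

lemma ExtraCondition.relIn_inf_le (h : ExtraCondition R) {n a b c : ℕ} (hac : a ≤ c) (hcb : c ≤ b)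
    (hba : b < a + N) (hbn : b + N ≤ n) : relIn R n a ⊓ relIn R n b ≤ relIn R n c := by
  obtain ⟨m, rfl⟩ := Nat.exists_eq_add_of_le (hac.trans hcb)
  obtain ⟨e, rfl⟩ := Nat.exists_eq_add_of_le hac
  obtain ⟨j, rfl⟩ := Nat.exists_eq_add_of_le hbn
  have key : ∀ i ≤ m, relIn R (a + m + N + j) (a + i) =
      tensorDeg k V a * relAt R i (m - i) * tensorDeg k V j := by
    intro i hi
    rw [tensorDeg_mul_relAt, relAt_mul_tensorDeg, relIn]
    congr 1
    omega
  have h0 := key 0 (by omega)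
  rw [add_zero] at h0
  have hle : ∀ i ≤ m, relAt R i (m - i) ≤ tensorDeg k V (N + m) := by
    intro i hi
    have := relAt_le R i (m - i)
    rwa [show i + N + (m - i) = N + m by omega] at this
  rw [key m le_rfl, key e (by omega), h0, mul_inf_mul _ _ le_rfl le_rfl, inf_idem,
    mul_inf_mul _ _ (hle 0 (by omega)) (hle m le_rfl), inf_idem, inf_comm, Nat.sub_self,
    Nat.sub_zero]
  exact mul_le_mul' (mul_le_mul' le_rfl (h.relAt_inf_le (by omega) (by omega))) le_rfl

variable (R) in
-- A relation standing to the left of `W` starts at a position `a` with `a + N + p ≤ n`. Truncated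
-- subtraction leaves an empty sum, hence `⊥`, when `n < N + p`.
lemma relSub_mul_inf_tensorDeg_le {W : Submodule k (TensorAlgebra k V)} {p : ℕ}
    (hW : W ≤ tensorDeg k V p) (n : ℕ) : relSub R * W ⊓ tensorDeg k V n ≤
      (Finset.range (n + 1 - (N + p))).sup (relIn R n) := by
  rcases lt_or_ge n p with hn | hn
  · rw [mul_inf_tensorDeg_eq_bot _ hW hn]
    exact bot_le
  · obtain ⟨m, rfl⟩ := Nat.exists_eq_add_of_le' hn
    refine ((isHomog_relSub R).mul_inf_tensorDeg_le hW m).trans ?_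
    refine (mul_le_mul' (relSub_inf_tensorDeg R m) hW).trans ?_
    rw [Submodule.iSup_mul]
    refine iSup_le fun q => ?_
    rw [Submodule.iSup_mul]
    refine iSup_le fun hq => ?_
    rw [relAt_mul_tensorDeg]
    have : relAt R q.1 (q.2 + p) = relIn R (m + p) q.1 := by
      rw [relIn]; congr 1; omega
    rw [this]
    exact Finset.le_sup (Finset.mem_range.2 (by omega))

/-- In degree `m + q` the element lies in all relation subspaces at positions `≥ m`, and in the sum
of those at positions `a ≤ m + q - N - p`. Distributivity treats one `a` at a time: either the
relation at `a` ends within the first `m` letters, or it overlaps the position `m` and the extra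
condition fills the gap. -/
lemma koszul_exact (hD : InfDistrib R) (hE : ExtraCondition R) {p q : ℕ} (hpq : p < q)
    (hqp : q ≤ p + N) (hq : N ≤ q ∨ (p = 0 ∧ q = 1)) :
    ⊤ * relInter R q ⊓ relSub R * relInter R p ≤
      ⊤ * relInter R (N + p) ⊔ relSub R * relInter R q := by
  intro x hx
  refine mem_of_proj_mem fun n => ?_
  have hx1 : proj k V n x ∈ ⊤ * relInter R q ⊓ tensorDeg k V n :=
    ⟨isHomog_top_mul (relInter_le R q) n x hx.1, proj_mem n x⟩
  have hx2 : proj k V n x ∈ relSub R * relInter R p ⊓ tensorDeg k V n :=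
    ⟨(isHomog_relSub R).mul (isHomog_of_le (relInter_le R p)) n x hx.2, proj_mem n x⟩
  generalize proj k V n x = y at hx1 hx2
  rcases lt_or_ge n q with hn | hn
  · rw [mul_inf_tensorDeg_eq_bot _ (relInter_le R q) hn, Submodule.mem_bot] at hx1
    rw [hx1]
    exact Submodule.zero_mem _
  obtain ⟨m, rfl⟩ := Nat.exists_eq_add_of_le' hn
  have h1 : y ∈ tensorDeg k V m * relInter R q :=
    (isHomog_top.mul_inf_tensorDeg_le (relInter_le R q) m).trans
      (mul_le_mul' inf_le_right le_rfl) hx1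
  have h2 := relSub_mul_inf_tensorDeg_le R (relInter_le R p) _ hx2
  have h1' := h1
  rw [tensorDeg_mul_relInter] at h1'
  have h3 := hD (m + q) _ _ (fun a ha => by have := Finset.mem_Ico.1 ha; omega)
    (fun a ha => by have := Finset.mem_range.1 ha; omega) ⟨h1'.2, h2⟩
  refine SetLike.le_def.1 (Finset.sup_le fun a ha => ?_) h3
  rw [Finset.mem_range] at ha
  rcases Nat.lt_or_ge m (a + N) with ham | ham
  -- Overlap: the target is `V^{⊗ (m + q - N - p)} ⊗ W_{N+p}`, that is, all positions `c ≥ m + q - N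
  -- - p`.
  · refine le_sup_of_le_left (le_trans ?_ (mul_le_mul' le_top le_rfl :
      tensorDeg k V (m + q - (N + p)) * relInter R (N + p) ≤ _))
    rw [tensorDeg_mul_relInter, show m + q - (N + p) + (N + p) = m + q by omega]
    refine le_inf (inf_le_right.trans (relIn_le R (by omega))) (Finset.le_inf fun c hc => ?_)
    rw [Finset.mem_Ico] at hc
    rcases Nat.lt_or_ge c m with hcm | hcm
    · rcases hq with hq | ⟨rfl, rfl⟩
      · refine le_trans (le_inf inf_le_right (inf_le_left.trans (Finset.inf_le
          (Finset.mem_Ico.2 ⟨le_rfl, ?_⟩)))) (hE.relIn_inf_le (b := m) ?_ ?_ ?_ ?_) <;> omega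
      · obtain rfl : c = a := by omega
        exact inf_le_right
    · exact inf_le_left.trans (Finset.inf_le (Finset.mem_Ico.2 ⟨hcm, hc.2⟩))
  -- No overlap: the relation at `a` and the factor `W_q` occupy disjoint letters, so the element
  -- lies in `I W_q`.
  · refine le_sup_of_le_right ?_
    have h4 : (Finset.Ico m (m + q + 1 - N)).inf (relIn R (m + q)) ⊓ relIn R (m + q) a ≤
        tensorDeg k V m * relInter R q ⊓ relIn R m a * tensorDeg k V q := by
      rw [tensorDeg_mul_relInter, relIn_mul_tensorDeg R q ham]
      exact le_inf (le_inf (inf_le_right.trans (relIn_le R (by omega))) inf_le_left) inf_le_right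
    refine h4.trans ?_
    rw [mul_inf_mul _ _ (relInter_le R q) le_rfl]
    exact mul_le_mul' (inf_le_right.trans (relAt_le_relSub R _ _)) inf_le_left

lemma jump_add_two (N i : ℕ) : jump N (i + 2) = N + jump N i := by
  simp only [jump, Nat.add_mod_right, Nat.add_div_right i two_pos, Nat.succ_mul]
  omega

lemma jump_lt_and_le {N : ℕ} (hN : 2 ≤ N) (i : ℕ) : jump N i < jump N (i + 1) ∧
    jump N (i + 1) ≤ jump N i + N ∧
    (N ≤ jump N (i + 1) ∨ (jump N i = 0 ∧ jump N (i + 1) = 1)) := by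
  induction i using Nat.twoStepInduction with
  | zero => simp [jump]; omega
  | one => simp [jump]; omega
  | more i ih _ =>
    rw [show i + 2 + 1 = i + 1 + 2 by rfl, jump_add_two, jump_add_two]
    omega

/-- Berger's criterion: a distributive algebra that satisfies the extra condition is Koszul. -/
theorem isKoszul_of_infDistrib (hN : 2 ≤ N) (hD : InfDistrib R) (hE : ExtraCondition R) :
    IsKoszul R := by
  refine ⟨freeResolution R (by omega) (fun i => relInter R (jump N i)) (jump N)
    (fun i => relInter_le R _) ?_ ?_ ?_ ?_ ?_,
    fun i n _ hn => freeResolution_tor R _ _ _ _ _ _ _ _ _ hn⟩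
  · rw [show jump N 0 = 0 by simp [jump], relInter_eq_tensorDeg R (by omega), tensorDeg_zero]
    exact Submodule.one_le.1 le_rfl
  · rw [show jump N 1 = 1 by simp [jump], relInter_eq_tensorDeg R (by omega)]
  · intro i
    obtain ⟨m, hm⟩ := Nat.exists_eq_add_of_le' (jump_lt_and_le hN i).1.le
    simp only [hm]
    exact (relInter_add_le R _ _).trans (mul_le_mul' le_top le_rfl)
  · intro i
    simp only [jump_add_two]
    exact relInter_add_le_relSub R _
  · intro i
    simp only [jump_add_two]
    obtain ⟨h1, h2, h3⟩ := jump_lt_and_le hN i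
    exact koszul_exact hD hE h1 h2 h3

end KoszulComplex

/-! ### Comparison with an arbitrary projective resolution. -/

section Lifting

variable {A : Type*} [Ring A] {P M₁ M₂ M₃ : Type*} [AddCommGroup P] [AddCommGroup M₁]
  [AddCommGroup M₂] [AddCommGroup M₃] [Module A P] [Module A M₁] [Module A M₂] [Module A M₃]

lemma exists_lift_of_le_range [Module.Projective A P] (a : M₁ →ₗ[A] M₂) (p : P →ₗ[A] M₂)
    (h : ∀ x, p x ∈ LinearMap.range a) : ∃ q : P →ₗ[A] M₁, a ∘ₗ q = p := by
  obtain ⟨q, hq⟩ := Module.projective_lifting_property a.rangeRestrict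
    (p.codRestrict (LinearMap.range a) h) a.surjective_rangeRestrict
  refine ⟨q, LinearMap.ext fun x => ?_⟩
  exact congrArg Subtype.val (LinearMap.congr_fun hq x)

lemma exists_lift_of_exact [Module.Projective A P] {a : M₁ →ₗ[A] M₂} {b : M₂ →ₗ[A] M₃}
    (hab : Function.Exact a b) (p : P →ₗ[A] M₂) (h : ∀ x, b (p x) = 0) :
    ∃ q : P →ₗ[A] M₁, ∀ x, a (q x) = p x := by
  obtain ⟨q, hq⟩ := exists_lift_of_le_range a p fun x => (hab _).1 (h x)
  exact ⟨q, LinearMap.congr_fun hq⟩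

end Lifting

section Comparison

variable {A : Type*} [Ring A] {M P₀ P₁ P₂ F₀ F₁ F₂ F₃ F₄ : Type*}
  [AddCommGroup M] [AddCommGroup P₀] [AddCommGroup P₁] [AddCommGroup P₂] [AddCommGroup F₀]
  [AddCommGroup F₁] [AddCommGroup F₂] [AddCommGroup F₃] [AddCommGroup F₄]
  [Module A M] [Module A P₀] [Module A P₁] [Module A P₂] [Module A F₀]
  [Module A F₁] [Module A F₂] [Module A F₃] [Module A F₄]
  [Module.Projective A P₀] [Module.Projective A P₁]
  [Module.Projective A F₀] [Module.Projective A F₁] [Module.Projective A F₂]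

/-- Comparison of the second syzygy module `ker d₂` of a projective presentation with a projective
resolution `F`: a syzygy whose image in `F₂` bounds an element of `I F₃ + δ₄ F₄` lies in
`I ker d₂`. -/
theorem mem_smul_ker_of_comparison (I : Ideal A)
    {ε : P₀ →ₗ[A] M} {d₁ : P₁ →ₗ[A] P₀} {d₂ : P₂ →ₗ[A] P₁}
    (hε : Function.Surjective ε) (hP₀ : Function.Exact d₁ ε) (hP₁ : Function.Exact d₂ d₁)
    {η : F₀ →ₗ[A] M} {δ₁ : F₁ →ₗ[A] F₀} {δ₂ : F₂ →ₗ[A] F₁} {δ₃ : F₃ →ₗ[A] F₂} {δ₄ : F₄ →ₗ[A] F₃}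
    (hF₀ : Function.Exact δ₁ η) (hF₁ : Function.Exact δ₂ δ₁) (hF₂ : Function.Exact δ₃ δ₂)
    (hF₃ : Function.Exact δ₄ δ₃)
    {f₀ : P₀ →ₗ[A] F₀} {f₁ : P₁ →ₗ[A] F₁} {f₂ : P₂ →ₗ[A] F₂}
    (hf₀ : ∀ x, η (f₀ x) = ε x) (hf₁ : ∀ x, δ₁ (f₁ x) = f₀ (d₁ x))
    (hf₂ : ∀ x, δ₂ (f₂ x) = f₁ (d₂ x))
    {x : P₂} (hx : d₂ x = 0) (hxI : x ∈ I • (⊤ : Submodule A P₂)) {y : F₃} (hy : δ₃ y = f₂ x)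
    (hyI : y ∈ I • (⊤ : Submodule A F₃) ⊔ LinearMap.range δ₄) :
    x ∈ I • LinearMap.ker d₂ := by
  obtain ⟨g₀, hg₀⟩ := Module.projective_lifting_property ε η hε
  replace hg₀ := LinearMap.congr_fun hg₀
  simp only [LinearMap.comp_apply] at hg₀
  obtain ⟨g₁, hg₁⟩ := exists_lift_of_exact hP₀ (g₀ ∘ₗ δ₁) fun z => by
    simp [hg₀, hF₀.apply_apply_eq_zero]
  obtain ⟨g₂, hg₂⟩ := exists_lift_of_exact hP₁ (g₁ ∘ₗ δ₂) fun z => by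
    simp [hg₁, hF₁.apply_apply_eq_zero]
  obtain ⟨h₀, hh₀⟩ := exists_lift_of_exact hP₀ (g₀ ∘ₗ f₀ - LinearMap.id) fun z => by
    simp [hg₀, hf₀]
  obtain ⟨h₁, hh₁⟩ := exists_lift_of_exact hP₁ (g₁ ∘ₗ f₁ - LinearMap.id - h₀ ∘ₗ d₁) fun z => by
    simp [hg₁, hf₁, hh₀]
  simp only [LinearMap.comp_apply, LinearMap.sub_apply, LinearMap.id_apply] at hg₁ hg₂ hh₀ hh₁
  -- Here `g ∘ f` is homotopic to the identity through `h₀`, `h₁`; the remaining defect `h₂` takes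
  -- values in `ker d₂`, and so maps `I P₂` into `I ker d₂`.
  let h₂ : P₂ →ₗ[A] P₂ := g₂ ∘ₗ f₂ - LinearMap.id - h₁ ∘ₗ d₂
  have e1 : h₂ x ∈ I • LinearMap.ker d₂ := by
    have := Submodule.mem_map_of_mem (f := h₂) hxI
    rw [Submodule.map_smul''] at this
    refine SetLike.le_def.1 (smul_mono_right I ?_) this
    rintro _ ⟨w, -, rfl⟩
    simp [h₂, hg₂, hh₁, hf₂, hP₁.apply_apply_eq_zero]
  -- `g₂ ∘ δ₃` takes values in `ker d₂` and kills the range of `δ₄`, so only the part of `y` in `I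
  -- F₃` contributes.
  have e2 : g₂ (f₂ x) ∈ I • LinearMap.ker d₂ := by
    rw [← hy]
    obtain ⟨y₁, hy₁, _, ⟨z, rfl⟩, rfl⟩ := Submodule.mem_sup.1 hyI
    rw [map_add, map_add, hF₃.apply_apply_eq_zero, map_zero, add_zero]
    have := Submodule.mem_map_of_mem (f := g₂ ∘ₗ δ₃) hy₁
    rw [Submodule.map_smul''] at this
    refine SetLike.le_def.1 (smul_mono_right I ?_) this
    rintro _ ⟨w, -, rfl⟩
    simp [hg₂, hF₂.apply_apply_eq_zero]
  have e3 : x = g₂ (f₂ x) - h₂ x := by simp [h₂, hx]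
  rw [e3]
  exact Submodule.sub_mem _ e2 e1

end Comparison

/-! ### Homogeneous preimages in graded resolutions. -/

section Components

variable {k : Type*} {M : Type*} [Field k] [AddCommGroup M] [Module k M] {deg : ℕ → Submodule k M}

/-- The projection onto the degree `n` part of a graded vector space. -/
def gradedProj (h : DirectSum.IsInternal deg) (n : ℕ) : M →ₗ[k] M :=
  (deg n).subtype ∘ₗ DirectSum.component k ℕ (fun i => deg i) n ∘ₗ
    (LinearEquiv.ofBijective (DirectSum.coeLinearMap deg) h).symm.toLinearMap

lemma gradedProj_mem (h : DirectSum.IsInternal deg) (n : ℕ) (x : M) :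
    gradedProj h n x ∈ deg n := Subtype.coe_prop _

lemma gradedProj_of_mem (h : DirectSum.IsInternal deg) {m n : ℕ} {x : M} (hx : x ∈ deg m) :
    gradedProj h n x = if m = n then x else 0 := by
  have : (LinearEquiv.ofBijective (DirectSum.coeLinearMap deg) h).symm x =
      DirectSum.lof k ℕ (fun i => deg i) m ⟨x, hx⟩ := by
    exact (LinearEquiv.symm_apply_eq _).2 (DirectSum.coeLinearMap_lof deg m ⟨x, hx⟩).symm
  simp only [gradedProj, LinearMap.comp_apply, LinearEquiv.coe_coe, this]
  split_ifs with hmn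
  · subst hmn
    simp [DirectSum.component.lof_self]
  · simp [DirectSum.component.of, hmn]

lemma ext_of_isInternal (h : DirectSum.IsInternal deg) {M' : Type*} [AddCommGroup M'] [Module k M']
    {f g : M →ₗ[k] M'} (hfg : ∀ n, ∀ x ∈ deg n, f x = g x) : f = g := by
  have : ⨆ n, deg n ≤ LinearMap.eqLocus f g := iSup_le fun n x hx => hfg n x hx
  rw [h.submodule_iSup_eq_top] at this
  exact LinearMap.ext fun x => this trivial

end Components

namespace GradedFreeResolution

variable {k : Type u} {V : Type v} [Field k] [AddCommGroup V] [Module k V] {N : ℕ}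
  {R : Submodule k (⨂[k]^N V)} (F : GradedFreeResolution R)

/-- The differential commutes with the projections onto degree `n`, so any preimage may be replaced
by its component. -/
lemma exists_homogeneous_preimage {i n : ℕ} {x : F.P i} (hx : x ∈ F.deg i n)
    (hx' : x ∈ LinearMap.range (F.d i)) : ∃ y ∈ F.deg (i + 1) n, F.d i y = x := by
  obtain ⟨y, rfl⟩ := hx'
  have h : (F.d i).restrictScalars k ∘ₗ gradedProj (F.isInternal (i + 1)) n =
      gradedProj (F.isInternal i) n ∘ₗ (F.d i).restrictScalars k := by
    refine ext_of_isInternal (F.isInternal (i + 1)) fun m z hz => ?_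
    simp only [LinearMap.comp_apply, LinearMap.restrictScalars_apply, gradedProj_of_mem _ hz,
      gradedProj_of_mem _ (F.d_mem i m z hz)]
    split_ifs <;> simp
  refine ⟨_, gradedProj_mem (F.isInternal (i + 1)) n y, ?_⟩
  have := LinearMap.congr_fun h y
  simp only [LinearMap.comp_apply, LinearMap.restrictScalars_apply, gradedProj_of_mem _ hx] at this
  simpa using this

lemma exists_aug_preimage (x : TrivialModule R) : ∃ y ∈ F.deg 0 0, F.aug y = x := by
  obtain ⟨y, rfl⟩ := F.aug_surjective x
  have h : F.aug.restrictScalars k ∘ₗ gradedProj (F.isInternal 0) 0 = F.aug.restrictScalars k := by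
    refine ext_of_isInternal (F.isInternal 0) fun m z hz => ?_
    simp only [LinearMap.comp_apply, LinearMap.restrictScalars_apply, gradedProj_of_mem _ hz]
    split_ifs with h
    · rfl
    · rw [map_zero, F.aug_eq_zero m z (by omega) hz]
  exact ⟨_, gradedProj_mem (F.isInternal 0) 0 y, LinearMap.congr_fun h y⟩

/-- `F` need not be minimal: `hdy` says exactly that `y` is a cycle of `k ⊗_A P`, and the vanishing
of `Tor` makes it a boundary modulo the augmentation ideal. -/
lemma mem_of_subsingleton_tor {i n : ℕ} (h : Subsingleton (F.Tor (i + 1) n)) {y : F.P (i + 1)}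
    (hy : y ∈ F.deg (i + 1) n)
    (hdy : F.d i y ∈ augIdeal R • (⊤ : Submodule (Alg R) (F.P i))) :
    y ∈ augIdeal R • (⊤ : Submodule (Alg R) (F.P (i + 1))) ⊔ LinearMap.range (F.d (i + 1)) := by
  rw [Submodule.Quotient.subsingleton_iff, Submodule.submoduleOf,
    Submodule.comap_subtype_eq_top] at h
  have h1 : Submodule.Quotient.mk y ∈ F.cycles (i + 1) n := by
    refine ⟨⟨y, hy, rfl⟩, ?_⟩
    exact (Submodule.Quotient.mk_eq_zero _).2 hdy
  obtain ⟨_, ⟨z, hz, rfl⟩, hzy⟩ := h h1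
  have h2 : y - F.d (i + 1) z ∈ augIdeal R • (⊤ : Submodule (Alg R) (F.P (i + 1))) := by
    rw [← Submodule.Quotient.mk_eq_zero, Submodule.Quotient.mk_sub, sub_eq_zero]
    exact hzy.symm
  exact Submodule.mem_sup.2 ⟨_, h2, _, ⟨z, rfl⟩, sub_add_cancel _ _⟩

end GradedFreeResolution

/-! ### Koszulness implies the extra condition. -/

section ExtraConditionOfKoszul

variable {k : Type u} {V : Type v} [Field k] [AddCommGroup V] [Module k V] {N : ℕ}
  {R : Submodule k (⨂[k]^N V)} {W : Submodule k (TensorAlgebra k V)} {l : ℕ}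

lemma exists_graded_lift {B C : Type*} [AddCommGroup B] [Module k B] [AddCommGroup C] [Module k C]
    {U : Type*} [AddCommGroup U] [Module k U] (D : Submodule k B) (a : B →ₗ[k] C) (p : U →ₗ[k] C)
    (h : ∀ x, ∃ y ∈ D, a y = p x) : ∃ q : U →ₗ[k] B, (∀ x, q x ∈ D) ∧ ∀ x, a (q x) = p x := by
  obtain ⟨q, hq⟩ := exists_lift_of_le_range (a ∘ₗ D.subtype) p fun x => by
    obtain ⟨y, hy, hyx⟩ := h x
    exact ⟨⟨y, hy⟩, hyx⟩
  exact ⟨D.subtype ∘ₗ q, fun x => (q x).2, LinearMap.congr_fun hq⟩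

lemma freeLift_mem_deg (F : GradedFreeResolution R) (hW : W ≤ tensorDeg k V l) {i : ℕ}
    {q : W →ₗ[k] F.P i} (hq : ∀ x, q x ∈ F.deg i l) {n : ℕ} {p : Alg R ⊗[k] W}
    (hp : p ∈ freeDeg R hW n) : freeLift R q p ∈ F.deg i n := by
  obtain ⟨x, hx, rfl⟩ := hp
  rcases lt_or_ge n l with h | h
  · rw [mul_inf_tensorDeg_eq_bot ⊤ hW h] at hx
    rw [(Submodule.mem_bot k).1 hx, map_zero, map_zero]
    exact Submodule.zero_mem _
  · obtain ⟨m, rfl⟩ := Nat.exists_eq_add_of_le' h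
    have h1 := isHomog_top.mul_inf_tensorDeg_le hW m hx
    clear hx
    induction h1 using Submodule.mul_induction_on' with
    | mem_mul_mem t ht w hw =>
      rw [toFree_mul R hW t ⟨w, hw⟩, freeLift_tmul]
      exact F.smul_mem i m l _ _ ⟨t, ht.2, rfl⟩ (hq _)
    | add x hx y hy h h' => rw [map_add, map_add]; exact Submodule.add_mem _ h h'

lemma freeLift_ext {U M : Type*} [AddCommGroup U] [Module k U] [AddCommGroup M] [Module k M]
    [Module (Alg R) M] [IsScalarTower k (Alg R) M] {f g : Alg R ⊗[k] U →ₗ[Alg R] M}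
    (h : ∀ x : U, f (1 ⊗ₜ x) = g (1 ⊗ₜ x)) (p : Alg R ⊗[k] U) : f p = g p := by
  induction p using TensorProduct.induction_on with
  | zero => simp
  | tmul a x =>
    rw [← mul_one a, ← smul_eq_mul, ← TensorProduct.smul_tmul', map_smul, map_smul, h]
  | add p q hp hq => rw [map_add, map_add, hp, hq]

instance (U : Type*) [AddCommGroup U] [Module k U] : Module.Projective (Alg R) (Alg R ⊗[k] U) :=
  Module.Projective.of_basis
    (Algebra.TensorProduct.basis (Alg R) (Module.Basis.ofVectorSpace k U))

variable (R) in
/-- The syzygies of the presentation `A ⊗ R → A ⊗ V → A`, as elements of the tensor algebra. -/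
def relSyz : Submodule k (TensorAlgebra k V) :=
  ⊤ * relSpace R ⊓ relSub R * tensorDeg k V 1

/-- Splitting the right factor of `T R T` as `T = k + T V` gives the two summands. This is exactness
of the presentation at `A ⊗ V`. -/
lemma relSub_le_sup : relSub R ≤ ⊤ * relSpace R ⊔ relSub R * tensorDeg k V 1 := by
  have h : (⊤ : Submodule k (TensorAlgebra k V)) ≤ 1 ⊔ tensorAug k V := by
    intro x _
    refine mem_of_proj_mem fun n => ?_
    rcases Nat.eq_zero_or_pos n with rfl | hn
    · refine Submodule.mem_sup_left ?_
      rw [← tensorDeg_zero]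
      exact proj_mem 0 x
    · exact Submodule.mem_sup_right (tensorDeg_le_tensorAug hn (proj_mem n x))
  conv_lhs => rw [relSub]
  refine (mul_le_mul' le_rfl h).trans ?_
  rw [Submodule.mul_sup, mul_one, tensorAug, ← mul_assoc]
  rfl

/-- Vanishing of `Tor_3` in degree `n` means that there are no new generators of the syzygies in
that degree. The presentation is compared with `F` by lifts preserving degrees, so that `Tor` is
needed only in degree `n`; `n ≠ N` puts the syzygy in `A_+ (A ⊗ R)`. -/
lemma relSyz_inf_le (hN : 1 ≤ N) (hK : IsKoszul R) {n : ℕ} (hn : n ≠ N + 1) (hn' : n ≠ N) :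
    relSyz R ⊓ tensorDeg k V n ≤ tensorAug k V * relSyz R ⊔ relSub R * relSpace R := by
  obtain ⟨F, hF⟩ := hK
  have hW2 := relSpace_le R
  have hd1 : tensorDeg k V 1 ≤ ⊤ * tensorDeg k V 0 := by
    rw [tensorDeg_zero, mul_one]; exact le_top
  have hd2 : relSpace R ≤ ⊤ * tensorDeg k V 1 := hW2.trans (tensorDeg_le_tensorAug hN)
  have hc : relSpace R ≤ relSub R * tensorDeg k V 0 := by
    rw [tensorDeg_zero, mul_one]; exact relSpace_le_relSub R
  have h1 : (1 : TensorAlgebra k V) ∈ tensorDeg k V 0 := by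
    rw [tensorDeg_zero]; exact Submodule.one_le.1 le_rfl
  have hP0 := freeMap_freeAug_exact R hN (le_refl (tensorDeg k V 0)) h1 rfl
  have hP1 := freeMap_exact R (le_refl (tensorDeg k V 0)) (le_refl (tensorDeg k V 1)) hW2 hd1 hd2 hc
    (by rw [tensorDeg_zero, mul_one]; exact inf_le_right.trans relSub_le_sup)
  have haug : Function.Surjective (freeAug R (tensorDeg k V 0)) := by
    intro a
    obtain ⟨a, rfl⟩ := Submodule.mkQ_surjective _ a
    obtain ⟨t, rfl⟩ := Ideal.Quotient.mk_surjective a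
    exact ⟨toFree R le_rfl t, freeAug_toFree R le_rfl
      (by rw [tensorDeg_zero, mul_one]; trivial)⟩
  obtain ⟨q0, hq0, hq0'⟩ := exists_graded_lift (F.deg 0 0) (F.aug.restrictScalars k)
    ((freeAug R (tensorDeg k V 0)).restrictScalars k ∘ₗ
      TensorProduct.mk k (Alg R) (tensorDeg k V 0) 1) fun x => F.exists_aug_preimage _
  have hf0 := freeLift_ext (f := F.aug ∘ₗ freeLift R q0) (g := freeAug R (tensorDeg k V 0))
    fun x => by simpa using hq0' x
  obtain ⟨q1, hq1, hq1'⟩ := exists_graded_lift (F.deg 1 1) ((F.d 0).restrictScalars k)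
    ((freeLift R q0 ∘ₗ freeMap R (tensorDeg k V 1) le_rfl).restrictScalars k ∘ₗ
      TensorProduct.mk k (Alg R) (tensorDeg k V 1) 1) fun x => F.exists_homogeneous_preimage
        (freeLift_mem_deg F le_rfl hq0 (freeMap_mem R le_rfl le_rfl hd1
          (one_tmul_mem_freeDeg R le_rfl x)))
        ((F.exact_zero _).1 ((hf0 _).trans (hP0.apply_apply_eq_zero _)))
  have hf1 := freeLift_ext (f := F.d 0 ∘ₗ freeLift R q1)
    (g := freeLift R q0 ∘ₗ freeMap R (tensorDeg k V 1) le_rfl) fun x => by simpa using hq1' x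
  obtain ⟨q2, hq2, hq2'⟩ := exists_graded_lift (F.deg 2 N) ((F.d 1).restrictScalars k)
    ((freeLift R q1 ∘ₗ freeMap R (relSpace R) le_rfl).restrictScalars k ∘ₗ
      TensorProduct.mk k (Alg R) (relSpace R) 1) fun x => F.exists_homogeneous_preimage
        (freeLift_mem_deg F le_rfl hq1 (freeMap_mem R le_rfl hW2 hd2
          (one_tmul_mem_freeDeg R hW2 x)))
        ((F.exact_succ 0 _).1 ((hf1 _).trans (by
          rw [LinearMap.comp_apply, hP1.apply_apply_eq_zero, map_zero])))
  have hf2 := freeLift_ext (f := F.d 1 ∘ₗ freeLift R q2)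
    (g := freeLift R q1 ∘ₗ freeMap R (relSpace R) le_rfl) fun x => by simpa using hq2' x
  rintro x ⟨⟨hx1, hx2⟩, hxn⟩
  have hpn : toFree R hW2 x ∈ freeDeg R hW2 n := ⟨x, ⟨hx1, hxn⟩, rfl⟩
  have hpI := freeDeg_le_augIdeal_smul R hW2 hn' hpn
  have hp0 : freeMap R (relSpace R) (le_refl (tensorDeg k V 1)) (toFree R hW2 x) = 0 := by
    rw [freeMap_toFree R le_rfl hW2 hd2 hx1,
      toFree_eq_zero_iff R le_rfl (top_mul_le_top_mul hd2 hx1)]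
    exact hx2
  obtain ⟨y, hy, hyp⟩ := F.exists_homogeneous_preimage (freeLift_mem_deg F hW2 hq2 hpn)
    ((F.exact_succ 1 _).1 ((hf2 _).trans (by rw [LinearMap.comp_apply, hp0, map_zero])))
  have hyI := F.mem_of_subsingleton_tor (hF 3 n le_rfl (by simpa [jump, add_comm] using hn)) hy (by
    rw [hyp]
    have := Submodule.mem_map_of_mem (f := freeLift R q2) hpI
    rw [Submodule.map_smul''] at this
    exact SetLike.le_def.1 (smul_mono_right (augIdeal R) le_top) this)
  have hprojF : ∀ i, Module.Projective (Alg R) (F.P i) := fun i =>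
    Module.Projective.of_basis (F.basis i)
  have hmem := mem_smul_ker_of_comparison (augIdeal R) haug hP0 hP1 F.exact_zero (F.exact_succ 0)
    (F.exact_succ 1) (F.exact_succ 2) hf0 hf1 hf2 hp0 hpI hyp hyI
  obtain ⟨z, hz, hzx⟩ : ∃ z ∈ tensorAug k V * relSyz R, toFree R hW2 z = toFree R hW2 x := by
    generalize toFree R hW2 x = p at hmem
    refine Submodule.smul_induction_on hmem (fun a ha b hb => ?_) ?_
    · obtain ⟨t, rfl⟩ := Ideal.Quotient.mk_surjective a
      obtain ⟨z, hz, rfl⟩ := toFree_surj R hW2 b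
      rw [LinearMap.mem_ker, freeMap_toFree R le_rfl hW2 hd2 hz,
        toFree_eq_zero_iff R le_rfl (top_mul_le_top_mul hd2 hz)] at hb
      exact ⟨t * z, Submodule.mul_mem_mul ((quot_mem_augIdeal R hN).1 ha) ⟨hz, hb⟩,
        toFree_mul_mem R hW2 hz t⟩
    · rintro _ _ ⟨z, hz, rfl⟩ ⟨z', hz', rfl⟩
      exact ⟨z + z', Submodule.add_mem _ hz hz', map_add _ _ _⟩
  have hzT : tensorAug k V * relSyz R ≤ ⊤ * relSpace R := by
    refine (mul_le_mul' le_top inf_le_left).trans ?_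
    rw [← mul_assoc, top_mul_top_tensorAlgebra]
  have h5 : toFree R hW2 (x - z) = 0 := by rw [map_sub, hzx, sub_self]
  rw [toFree_eq_zero_iff R hW2 (Submodule.sub_mem _ hx1 (hzT hz))] at h5
  exact Submodule.mem_sup.2 ⟨z, hz, _, h5, add_sub_cancel _ _⟩

lemma relSyz_inf_eq_bot {n : ℕ} (hn : n ≤ N) : relSyz R ⊓ tensorDeg k V n = ⊥ := by
  rw [eq_bot_iff]
  refine (inf_le_inf_right _ inf_le_right).trans
    ((relSub_mul_inf_tensorDeg_le R le_rfl n).trans ?_)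
  rw [show n + 1 - (N + 1) = 0 by omega]
  simp

lemma isHomog_relSyz : IsHomog (relSyz R) :=
  (isHomog_top_mul (relSpace_le R)).inf ((isHomog_relSub R).mul (isHomog_of_le le_rfl))

lemma tensorAug_mul_le_iSup {S : Submodule k (TensorAlgebra k V)} (hS : IsHomog S) :
    tensorAug k V * S ≤
      ⨆ p : ℕ × ℕ, tensorDeg k V (p.1 + 1) * (S ⊓ tensorDeg k V p.2) := by
  have h : S ≤ ⨆ e, S ⊓ tensorDeg k V e := fun x hx =>
    mem_of_proj_mem fun n => Submodule.mem_iSup_of_mem n ⟨hS n x hx, proj_mem n x⟩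
  refine (mul_le_mul' le_rfl h).trans ?_
  rw [tensorAug, ← iSup_tensorDeg, Submodule.iSup_mul, Submodule.iSup_mul]
  refine iSup_le fun i => ?_
  rw [Submodule.mul_iSup, tensorDeg_mul]
  exact iSup_le fun e => le_iSup_of_le (i, e) le_rfl

/-- In degree `N + 1` a syzygy lies in the degree `N + 1` part of `I V`, which is `R ⊗ V`. In
degrees up to `2N - 1` the later syzygies come from multiplying earlier ones on the left, which
keeps the form `V^{⊗ j} ⊗ R ⊗ V`. -/
lemma relSyz_inf_le_relAt (hN : 1 ≤ N) (hK : IsKoszul R) {j : ℕ} (hj : j + 1 < N) :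
    relSyz R ⊓ tensorDeg k V (N + j + 1) ≤ relAt R j 1 := by
  induction j using Nat.strong_induction_on with
  | _ j ih =>
    rcases Nat.eq_zero_or_pos j with rfl | hj0
    · refine (inf_le_inf_right _ inf_le_right).trans
        ((relSub_mul_inf_tensorDeg_le R le_rfl _).trans (Finset.sup_le fun a ha => ?_))
      rw [Finset.mem_range] at ha
      obtain rfl : a = 0 := by omega
      rw [relIn, show N + 0 + 1 - N - 0 = 1 by omega]
    · intro x hx
      obtain ⟨a, ha, b, hb, hab⟩ :=
        Submodule.mem_sup.1 (relSyz_inf_le hN hK (by omega) (by omega) hx)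
      -- Two disjoint relations need degree at least `2N`, while `N + j + 1 < 2N`; so `I R` does not
      -- contribute.
      have hb0 : proj k V (N + j + 1) b = 0 := by
        have h1 := relSub_mul_inf_tensorDeg_le R (relSpace_le R) (N + j + 1)
          ⟨(isHomog_relSub R).mul (isHomog_of_le (relSpace_le R)) (N + j + 1) b hb, proj_mem _ b⟩
        rw [show N + j + 1 + 1 - (N + N) = 0 by omega] at h1
        simpa using h1
      have hxa : x = proj k V (N + j + 1) a := by
        rw [← proj_of_mem hx.2, ← hab, map_add, hb0, add_zero]
      rw [hxa]
      have h2 := proj_mem_iSup (n := N + j + 1) (d := fun p : ℕ × ℕ => p.1 + 1 + p.2)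
        (S := fun p => tensorDeg k V (p.1 + 1) * (relSyz R ⊓ tensorDeg k V p.2))
        (fun p => (mul_le_mul' le_rfl inf_le_right).trans (tensorDeg_mul _ _).le)
        (tensorAug_mul_le_iSup isHomog_relSyz ha)
      refine SetLike.le_def.1 (iSup₂_le fun p hp => ?_) h2
      rcases Nat.lt_or_ge N p.2 with h | h
      · obtain ⟨e, he⟩ := Nat.exists_eq_add_of_lt h
        rw [he]
        refine (mul_le_mul' le_rfl (ih e (by omega) (by omega))).trans ?_
        rw [tensorDeg_mul_relAt, show p.1 + 1 + e = j by omega]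
      · rw [relSyz_inf_eq_bot h, Submodule.mul_bot]
        exact bot_le

/-- A Koszul algebra satisfies the extra condition. -/
theorem IsKoszul.extraCondition (hN : 1 ≤ N) (hK : IsKoszul R) : ExtraCondition R := by
  intro m _ hmN
  have h1 : relAt R (m + 1) 0 ≤ ⊤ * relSpace R := by
    rw [relAt, tensorDeg_zero, mul_one]
    exact mul_le_mul' le_top le_rfl
  have h2 : relAt R 0 (m + 1) ≤ relSub R * tensorDeg k V 1 := by
    rw [← relAt_mul_tensorDeg]
    exact mul_le_mul' (relAt_le_relSub R _ _) le_rfl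
  have h3 : relAt R 0 (m + 1) ≤ tensorDeg k V (N + m + 1) := by
    have := relAt_le R 0 (m + 1)
    rwa [show 0 + N + (m + 1) = N + m + 1 by omega] at this
  exact (le_inf (le_inf (inf_le_left.trans h1) (inf_le_right.trans h2))
    (inf_le_right.trans h3)).trans (relSyz_inf_le_relAt hN hK hmN)

end ExtraConditionOfKoszul

end HomogAlg

end

theorem proposition2p8 {k : Type*} [Field k]
    {V : Type*} [AddCommGroup V] [Module k V] [FiniteDimensional k V]
    {V' : Type*} [AddCommGroup V'] [Module k V'] [FiniteDimensional k V']
    (N : ℕ) (hN : 2 ≤ N)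
    (R : Submodule k (⨂[k]^N V)) (R' : Submodule k (⨂[k]^N V'))
    (hdist : HomogAlg.IsDistributive R) (hdist' : HomogAlg.IsDistributive R')
    (hkoszul : HomogAlg.IsKoszul R) (hkoszul' : HomogAlg.IsKoszul R') :
    HomogAlg.IsKoszul (HomogAlg.maninRel R R') :=
  HomogAlg.isKoszul_of_infDistrib hN (HomogAlg.infDistrib_maninRel hdist hdist')
    (HomogAlg.extraCondition_maninRel (hkoszul.extraCondition (by omega))
      (hkoszul'.extraCondition (by omega)))
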